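/- Let $d\ge 1$ and let $\mathcal D\subset\mathbb R^d$ be a bounded Lipschitz domain (open, connected, non-empty, bounded, and locally near each boundary point, in suitable orthonormal coordinates, the strict epigraph of a Lipschitz function). Let $L^2(\partial\mathcal D)$ be taken with respect to surface measure, and put $$L^2_m(\partial\mathcal D)=\Big\{g\in L^2(\partial\mathcal D):\int_{\partial\mathcal D}g=0\Big\},\qquad H^1_m(\mathcal D)=\Big\{u\in H^1(\mathcal D):\int_{\partial\mathcal D}u=0\Big\}.$$ For $\alpha,\beta>0$ let $\mathcal S_{\alpha,\beta}$ be the set of symmetric matrices $M\in\mathbb R^{d\times d}$ with $\alpha|\xi|^2\le \xi^TM\xi$ and $|\xi^TM\eta|\le\beta|\xi||\eta|$ for all $\xi,\eta\in\mathbb R^d$. For $A\in L^\infty(\mathcal D,\mathcal S_{\alpha,\beta})$ and $g\in L^2_m(\partial\mathcal D)$ let $u(A,g)$ denote the weak solution in $H^1_m(\mathcal D)$ of $$-\operatorname{div}(A\nabla u)=0\ \text{ in }\mathcal D,\qquad (A\nabla u)\cdot n=g\ \text{ on }\partial\mathcal D,$$ that is, $\int_{\mathcal D}\nabla v^TA\nabla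 u=\int_{\partial\mathcal D}g\,v$ for all $v\in H^1(\mathcal D)$, and let $$\mathcal E(A,g)=\frac12\int_{\mathcal D}\nabla u(A,g)^TA\,\nabla u(A,g)-\int_{\partial\mathcal D}g\,u(A,g).$$ Let $(A_\varepsilon)_{\varepsilon>0}$ be a family with $A_\varepsilon\in L^\infty(\mathcal D,\mathcal S_{\alpha,\beta})$ for every $\varepsilon>0$. For a constant matrix $\overline A\in\mathcal S_{\alpha,\beta}$ define $$\Psi^{\mathrm{ME}}_\varepsilon(\overline A)=\sup_{g}\big|\mathcal E(A_\varepsilon,g)-\mathcal E(\overline A,g)\big|,\qquad \Psi^{\mathrm{MS}}_\varepsilon(\overline A)=\sup_{g}\big\|u(A_\varepsilon,g)-u(\overline A,g)\big\|_{L^2(\partial\mathcal D)},$$ both suprema being over $g\in L^2_m(\partial\mathcal D)$ with $\|g\|_{L^2(\partial\mathcal D)}=1$. Then, for every $\varepsilon>0$ and every $\overline A\in\mathcal S_{\alpha,\beta}$, the Neumann problems with coefficients $A_\varepsilon$ and $\overline A$ have, for each $g\in L^2_m(\partial\mathcal D)$, exactly one solution in $H^1_m(\mathcal D)$, both suprema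 are finite, and $$\Psi^{\mathrm{ME}}_\varepsilon(\overline A)=\tfrac12\,\Psi^{\mathrm{MS}}_\varepsilon(\overline A).$$ -/

import Mathlib

open MeasureTheory Filter Topology
open scoped ENNReal NNReal ContDiff Matrix InnerProductSpace

noncomputable section

namespace NeumannHom

/-- `ℝᵈ` with its Euclidean norm. -/
abbrev Rd (d : ℕ) : Type := EuclideanSpace ℝ (Fin d)

/-- A bounded Lipschitz domain: open, connected, non-empty, bounded, and, near every boundary
point, in suitable orthonormal coordinates, the strict epigraph of a Lipschitz function of the
coordinates in the hyperplane `eᗮ`. -/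
structure IsLipschitzDomain {d : ℕ} (D : Set (Rd d)) : Prop where
  isOpen : IsOpen D
  isConnected : IsConnected D
  isBounded : Bornology.IsBounded D
  lipschitz_boundary : ∀ x ∈ frontier D, ∃ (e : Rd d) (r : ℝ) (K : ℝ≥0)
    (h : ((Submodule.span ℝ {e})ᗮ : Submodule ℝ (Rd d)) → ℝ),
    ‖e‖ = 1 ∧ 0 < r ∧ LipschitzWith K h ∧
      ∀ y ∈ Metric.ball x r,
        y ∈ D ↔ h ((Submodule.span ℝ {e})ᗮ.orthogonalProjectionOnto y) < ⟪e, y⟫_ℝ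

/-- The surface measure on `∂D`: the `(d-1)`-dimensional Hausdorff measure, normalized so as to
agree with Lebesgue measure on hyperplanes, restricted to the topological boundary of `D`. -/
def surfaceMeasure {d : ℕ} (D : Set (Rd d)) : Measure (Rd d) :=
  (μHE[d - 1] : Measure (Rd d)).restrict (frontier D)

/-- `L²(D)`. -/
abbrev L2 {d : ℕ} (D : Set (Rd d)) : Type := Lp ℝ 2 (volume.restrict D)

/-- `L²(D; ℝᵈ)`. -/
abbrev L2Vec {d : ℕ} (D : Set (Rd d)) : Type := Lp (Rd d) 2 (volume.restrict D)

/-- `L²(∂D)`. -/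
abbrev L2Bdry {d : ℕ} (D : Set (Rd d)) : Type := Lp ℝ 2 (surfaceMeasure D)

/-- `L²_m(∂D)`, the elements of `L²(∂D)` of zero mean. -/
def L2BdryMean {d : ℕ} (D : Set (Rd d)) : Set (L2Bdry D) :=
  {g | ∫ x, g x ∂(surfaceMeasure D) = 0}

/-- `G` is the weak gradient of `u` in `D`. -/
def IsWeakGradient {d : ℕ} (D : Set (Rd d)) (u : Rd d → ℝ) (G : Rd d → Rd d) : Prop :=
  ∀ φ : Rd d → ℝ, ContDiff ℝ ∞ φ → HasCompactSupport φ → tsupport φ ⊆ D →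
    ∀ i : Fin d,
      ∫ x in D, u x * fderiv ℝ φ x (EuclideanSpace.single i 1) = - ∫ x in D, G x i * φ x

/-- The Sobolev space `H¹(D)`: functions in `L²(D)` with a weak gradient in `L²(D)`. -/
structure H1 {d : ℕ} (D : Set (Rd d)) where
  /-- the function -/
  fn : L2 D
  /-- its weak gradient -/
  grad : L2Vec D
  isWeakGradient : IsWeakGradient D fn grad

instance {d : ℕ} (D : Set (Rd d)) : Inhabited (H1 D) :=
  ⟨{ fn := 0
     grad := 0
     isWeakGradient := by
      intro φ _ _ _ i
      have h1 : ∫ x in D, (0 : L2 D) x * fderiv ℝ φ x (EuclideanSpace.single i 1) = 0 := by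
        refine integral_eq_zero_of_ae ?_
        filter_upwards [Lp.coeFn_zero ℝ 2 (volume.restrict D)] with x hx
        beta_reduce
        rw [hx]
        simp
      have h2 : ∫ x in D, (0 : L2Vec D) x i * φ x = 0 := by
        refine integral_eq_zero_of_ae ?_
        filter_upwards [Lp.coeFn_zero (Rd d) 2 (volume.restrict D)] with x hx
        beta_reduce
        rw [hx]
        simp
      rw [h1, h2, neg_zero] }⟩

/-- `γ ∈ L²(∂D)` is the trace of `u ∈ H¹(D)`: the limit in `L²(∂D)` of the restrictions to `∂D`
of functions, smooth up to the boundary, that converge to `u` in `H¹(D)`. -/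
def IsTrace {d : ℕ} {D : Set (Rd d)} (u : H1 D) (γ : L2Bdry D) : Prop :=
  ∃ φ : ℕ → Rd d → ℝ, (∀ n, ContDiff ℝ ∞ (φ n)) ∧
    Tendsto (fun n => eLpNorm (fun x => φ n x - u.fn x) 2 (volume.restrict D)) atTop (𝓝 0) ∧
    Tendsto (fun n => eLpNorm (fun x => gradient (φ n) x - u.grad x) 2 (volume.restrict D))
      atTop (𝓝 0) ∧
    Tendsto (fun n => eLpNorm (fun x => φ n x - γ x) 2 (surfaceMeasure D)) atTop (𝓝 0)

/-- `ξᵀ M η`. -/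
def bilin {d : ℕ} (M : Matrix (Fin d) (Fin d) ℝ) (ξ η : Rd d) : ℝ :=
  ξ.ofLp ⬝ᵥ (M *ᵥ η.ofLp)

/-- `S_{α,β}`: the symmetric, `α`-coercive, `β`-bounded matrices. -/
def coeffSet (d : ℕ) (α β : ℝ) : Set (Matrix (Fin d) (Fin d) ℝ) :=
  {M | M.IsSymm ∧ (∀ ξ : Rd d, α * ‖ξ‖ ^ 2 ≤ bilin M ξ ξ) ∧
    ∀ ξ η : Rd d, |bilin M ξ η| ≤ β * ‖ξ‖ * ‖η‖}

/-- `A ∈ L^∞(D, S_{α,β})`. -/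
def IsCoeffField {d : ℕ} (D : Set (Rd d)) (α β : ℝ)
    (A : Rd d → Matrix (Fin d) (Fin d) ℝ) : Prop :=
  (∀ i j, AEMeasurable (fun x => A x i j) (volume.restrict D)) ∧
    ∀ᵐ x ∂(volume.restrict D), A x ∈ coeffSet d α β

/-- `u`, with trace `γ`, is a solution in `H¹_m(D)` (zero mean on the boundary) of the variational
formulation of `-div (A ∇u) = 0` in `D`, `(A ∇u) · n = g` on `∂D`. -/
def IsSolution {d : ℕ} (D : Set (Rd d)) (A : Rd d → Matrix (Fin d) (Fin d) ℝ) (g : L2Bdry D)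
    (u : H1 D) (γ : L2Bdry D) : Prop :=
  IsTrace u γ ∧ ∫ x, γ x ∂(surfaceMeasure D) = 0 ∧
    ∀ (v : H1 D) (τ : L2Bdry D), IsTrace v τ →
      ∫ x in D, bilin (A x) (v.grad x) (u.grad x) = ∫ x, g x * τ x ∂(surfaceMeasure D)

/-- The Neumann problem with coefficient `A` has, for every `g ∈ L²_m(∂D)`, exactly one solution
in `H¹_m(D)`. -/
def IsWellPosed {d : ℕ} (D : Set (Rd d)) (A : Rd d → Matrix (Fin d) (Fin d) ℝ) : Prop :=
  ∀ g ∈ L2BdryMean D, ∃! p : H1 D × L2Bdry D, IsSolution D A g p.1 p.2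

/-- The solution `u(A, g)` of the Neumann problem, together with its trace on `∂D`. -/
def solution {d : ℕ} (D : Set (Rd d)) (A : Rd d → Matrix (Fin d) (Fin d) ℝ) (g : L2Bdry D) :
    H1 D × L2Bdry D :=
  Classical.epsilon fun p => IsSolution D A g p.1 p.2

/-- The stored energy `E(A, g) = ½ ∫_D ∇uᵀ A ∇u - ∫_{∂D} g u`, with `u = u(A, g)`. -/
def energy {d : ℕ} (D : Set (Rd d)) (A : Rd d → Matrix (Fin d) (Fin d) ℝ) (g : L2Bdry D) : ℝ :=
  (1 / 2) * (∫ x in D, bilin (A x) ((solution D A g).1.grad x) ((solution D A g).1.grad x))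
    - ∫ x, g x * (solution D A g).2 x ∂(surfaceMeasure D)

/-- The unit sphere of `L²_m(∂D)`. -/
def unitData {d : ℕ} (D : Set (Rd d)) : Set (L2Bdry D) :=
  {g | g ∈ L2BdryMean D ∧ ‖g‖ = 1}

/-- The values `|E(A, g) - E(B, g)|` over the unit sphere of `L²_m(∂D)`. -/
def valuesME {d : ℕ} (D : Set (Rd d)) (A B : Rd d → Matrix (Fin d) (Fin d) ℝ) : Set ℝ :=
  (fun g => |energy D A g - energy D B g|) '' unitData D

/-- The values `‖u(A, g) - u(B, g)‖_{L²(∂D)}` over the unit sphere of `L²_m(∂D)`. -/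
def valuesMS {d : ℕ} (D : Set (Rd d)) (A B : Rd d → Matrix (Fin d) (Fin d) ℝ) : Set ℝ :=
  (fun g => ‖(solution D A g).2 - (solution D B g).2‖) '' unitData D

/-- `Ψ^ME` for the oscillating coefficient `A` and the constant coefficient `Abar`. -/
def PsiME {d : ℕ} (D : Set (Rd d)) (A : Rd d → Matrix (Fin d) (Fin d) ℝ)
    (Abar : Matrix (Fin d) (Fin d) ℝ) : ℝ :=
  sSup (valuesME D A fun _ => Abar)

/-- `Ψ^MS` for the oscillating coefficient `A` and the constant coefficient `Abar`. -/
def PsiMS {d : ℕ} (D : Set (Rd d)) (A : Rd d → Matrix (Fin d) (Fin d) ℝ)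
    (Abar : Matrix (Fin d) (Fin d) ℝ) : ℝ :=
  sSup (valuesMS D A fun _ => Abar)

end NeumannHom

end

noncomputable section

namespace NeumannHom

/-! Let `T_A` be the Neumann-to-Dirichlet operator, sending `g` to the trace of `u(A, g)`. Testing
the equation with the solution itself gives `E(A, g) = -½ ⟪g, T_A g⟫` (`energy_eq`), and symmetry of
`A` makes `T_A` symmetric (`inner_neumannToDirichlet_comm`). With `S` the difference of the two
operators, one supremum is that of `½ |⟪g, S g⟫|` and the other that of `‖S g‖`, over the unit
sphere of the zero-mean data. Since `S` is bounded, symmetric and has zero-mean values, polarization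
and the parallelogram law show that its quadratic form and its norm have the same supremum
(`bddAbove_and_sSup_eq`).

Most of the work is the construction of `T_A`. It takes place in the closure, inside a product of
`L²` spaces, of the triples (function, gradient, trace) of smooth functions with zero boundary mean.
On this Hilbert space the gradient controls the full norm (`norm_sq_le_grad`), so Lax-Milgram
applies. The control rests on a Poincaré inequality (`hasPoincare`), a trace inequality
(`trace_le`), and the surface measure being finite and non-zero. Both inequalities come from
integrating gradients along segments, without any compact embedding. Finally `exists_mem_of_isTrace`
identifies the closure with the pairs (function, trace) of the definitions, up to constants, which
gives existence and uniqueness among all such pairs. -/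

/-! ### Elementary inequalities and gradients along segments -/

lemma enorm_add_sq_le {E : Type*} [NormedAddCommGroup E] (a b : E) :
    ‖a + b‖ₑ ^ 2 ≤ 2 * (‖a‖ₑ ^ 2 + ‖b‖ₑ ^ 2) := by
  have h := ENNReal.rpow_add_le_mul_rpow_add_rpow ‖a‖ₑ ‖b‖ₑ (p := 2) (by norm_num)
  norm_num at h
  exact (pow_le_pow_left' (enorm_add_le a b) 2).trans h

lemma lintegral_two_mul_add {X : Type*} [MeasurableSpace X] (μ : Measure X) {f g : X → ℝ≥0∞}
    (hf : Measurable f) (hg : Measurable g) :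
    ∫⁻ x, 2 * (f x + g x) ∂μ = 2 * ((∫⁻ x, f x ∂μ) + ∫⁻ x, g x ∂μ) := by
  rw [lintegral_const_mul _ (by fun_prop), lintegral_add_left hf]

/-- Cauchy-Schwarz against the constant function 1. -/
lemma sq_lintegral_le_measure_mul {X : Type*} [MeasurableSpace X] (μ : Measure X) {f : X → ℝ≥0∞}
    (hf : AEMeasurable f μ) : (∫⁻ x, f x ∂μ) ^ 2 ≤ μ Set.univ * ∫⁻ x, f x ^ 2 ∂μ := by
  have h := ENNReal.lintegral_mul_le_Lp_mul_Lq μ Real.HolderConjugate.two_two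
    (f := fun _ => 1) (g := f) aemeasurable_const hf
  simp only [Pi.mul_apply, one_mul, ENNReal.one_rpow, lintegral_one] at h
  calc (∫⁻ x, f x ∂μ) ^ 2
      ≤ (μ Set.univ ^ (1 / (2 : ℝ)) * (∫⁻ x, f x ^ (2 : ℝ) ∂μ) ^ (1 / (2 : ℝ))) ^ 2 := by gcongr
    _ = μ Set.univ * ∫⁻ x, f x ^ 2 ∂μ := by
        rw [mul_pow, ← ENNReal.rpow_natCast, ← ENNReal.rpow_natCast, ← ENNReal.rpow_mul,
          ← ENNReal.rpow_mul]
        norm_num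

variable {d : ℕ}

lemma continuous_gradient {φ : Rd d → ℝ} (hφ : ContDiff ℝ ∞ φ) : Continuous (gradient φ) :=
  (InnerProductSpace.toDual ℝ (Rd d)).symm.continuous.comp (hφ.continuous_fderiv (by simp))

lemma fderiv_eq_inner_gradient (φ : Rd d → ℝ) (x w : Rd d) :
    fderiv ℝ φ x w = ⟪gradient φ x, w⟫_ℝ := by
  simp [gradient]

/-- The fundamental theorem of calculus on a segment, combined with Cauchy-Schwarz. -/
lemma enorm_sub_sq_le_lintegral_gradient {φ : Rd d → ℝ} (hφ : ContDiff ℝ ∞ φ) (x e : Rd d)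
    {t : ℝ} (ht : 0 ≤ t) :
    ‖φ (x + t • e) - φ x‖ₑ ^ 2 ≤
      ENNReal.ofReal t * (‖e‖ₑ ^ 2 * ∫⁻ s in Set.Ioc 0 t, ‖gradient φ (x + s • e)‖ₑ ^ 2) := by
  have hc : Continuous fun s : ℝ => x + s • e := by fun_prop
  have hgc : Continuous fun s : ℝ => gradient φ (x + s • e) := (continuous_gradient hφ).comp hc
  have hder : ∀ s ∈ Set.uIcc 0 t,
      HasDerivAt (fun s : ℝ => φ (x + s • e)) ⟪gradient φ (x + s • e), e⟫_ℝ s := by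
    intro s _
    have h1 : HasDerivAt (fun s : ℝ => x + s • e) e s := by
      simpa using ((hasDerivAt_id s).smul_const e).const_add x
    have h2 := (hφ.differentiable (by simp) (x + s • e)).hasFDerivAt.comp_hasDerivAt s h1
    rwa [fderiv_eq_inner_gradient] at h2
  have hint := intervalIntegral.integral_eq_sub_of_hasDerivAt hder
    ((hgc.inner continuous_const).intervalIntegrable 0 t)
  simp only [zero_smul, add_zero] at hint
  rw [← hint, intervalIntegral.integral_of_le ht]
  calc _ ≤ (∫⁻ s in Set.Ioc 0 t, ‖e‖ₑ * ‖gradient φ (x + s • e)‖ₑ) ^ 2 := by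
        gcongr
        refine (enorm_integral_le_lintegral_enorm _).trans (lintegral_mono fun s => ?_)
        have := norm_inner_le_norm (𝕜 := ℝ) (gradient φ (x + s • e)) e
        rw [mul_comm, ← enorm_norm e, ← enorm_norm (gradient φ _), ← enorm_mul]
        exact enorm_le_iff_norm_le.2 (by simpa using this)
    _ = ‖e‖ₑ ^ 2 * (∫⁻ s in Set.Ioc 0 t, ‖gradient φ (x + s • e)‖ₑ) ^ 2 := by
        rw [lintegral_const_mul _ hgc.enorm.measurable, mul_pow]
    _ ≤ ‖e‖ₑ ^ 2 * (ENNReal.ofReal t * ∫⁻ s in Set.Ioc 0 t, ‖gradient φ (x + s • e)‖ₑ ^ 2) := by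
        gcongr
        refine (sq_lintegral_le_measure_mul _ hgc.enorm.measurable.aemeasurable).trans_eq ?_
        simp
    _ = _ := by ring

/-- The segment bound is integrated over `S` and the integrals are swapped. For each fixed `t` the
translation by `t • w` carries `S` into `D`, so translation invariance bounds the inner integral
independently of `t`. -/
lemma lintegral_translate_sub_sq_le {φ : Rd d → ℝ} (hφ : ContDiff ℝ ∞ φ) {S D : Set (Rd d)}
    (hS : MeasurableSet S) (hD : MeasurableSet D) (w : Rd d)
    (hw : ∀ x ∈ S, ∀ t ∈ Set.Ioc (0 : ℝ) 1, x + t • w ∈ D) :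
    ∫⁻ x in S, ‖φ (x + w) - φ x‖ₑ ^ 2 ≤ ‖w‖ₑ ^ 2 * ∫⁻ x in D, ‖gradient φ x‖ₑ ^ 2 := by
  have hgm : Measurable fun x => ‖gradient φ x‖ₑ ^ 2 :=
    (continuous_gradient hφ).enorm.measurable.pow_const 2
  have hm : Measurable fun p : Rd d × ℝ => ‖gradient φ (p.1 + p.2 • w)‖ₑ ^ 2 :=
    hgm.comp (by fun_prop)
  calc ∫⁻ x in S, ‖φ (x + w) - φ x‖ₑ ^ 2
      ≤ ∫⁻ x in S, ‖w‖ₑ ^ 2 * ∫⁻ t in Set.Ioc (0 : ℝ) 1, ‖gradient φ (x + t • w)‖ₑ ^ 2 := by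
        refine lintegral_mono fun x => ?_
        simpa using enorm_sub_sq_le_lintegral_gradient hφ x w zero_le_one
    _ = ‖w‖ₑ ^ 2 * ∫⁻ t in Set.Ioc (0 : ℝ) 1, ∫⁻ x in S, ‖gradient φ (x + t • w)‖ₑ ^ 2 := by
        rw [lintegral_const_mul _ hm.lintegral_prod_right', lintegral_lintegral_swap]
        exact hm.aemeasurable
    _ ≤ ‖w‖ₑ ^ 2 * ∫⁻ t in Set.Ioc (0 : ℝ) 1, ∫⁻ x in D, ‖gradient φ x‖ₑ ^ 2 := by
        gcongr ‖w‖ₑ ^ 2 * ?_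
        refine setLIntegral_mono' measurableSet_Ioc fun t ht => ?_
        rw [← lintegral_indicator hS, ← lintegral_indicator hD,
          ← lintegral_add_right_eq_self (D.indicator _) (t • w)]
        refine lintegral_mono fun x => ?_
        by_cases hx : x ∈ S
        · simp [hx, hw x hx t ht]
        · simp [hx]
    _ = _ := by simp

/-! ### The Poincaré inequality -/

/-- A Poincaré inequality on `U`, with the gradient measured on `D`. -/
def HasPoincare (D U : Set (Rd d)) : Prop :=
  ∃ C : ℝ≥0∞, C ≠ ⊤ ∧ ∀ φ : Rd d → ℝ, ContDiff ℝ ∞ φ →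
    ∃ c : ℝ, ∫⁻ x in U, ‖φ x - c‖ₑ ^ 2 ≤ C * ∫⁻ x in D, ‖gradient φ x‖ₑ ^ 2

lemma HasPoincare.mono {D U V : Set (Rd d)} (h : HasPoincare D V) (hUV : U ⊆ V) :
    HasPoincare D U := by
  obtain ⟨C, hC, h⟩ := h
  refine ⟨C, hC, fun φ hφ => ?_⟩
  obtain ⟨c, hc⟩ := h φ hφ
  exact ⟨c, (lintegral_mono_set hUV).trans hc⟩

/-- On the overlap, which has positive measure, `φ` is close to both constants, so these are close
to each other. The constant of `U` can then replace that of `V` at a cost proportional to the volume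
of `V`. -/
lemma HasPoincare.union {D U V : Set (Rd d)} (hU : HasPoincare D U) (hV : HasPoincare D V)
    (hUV : volume (U ∩ V) ≠ 0) (hVfin : volume V ≠ ⊤) : HasPoincare D (U ∪ V) := by
  obtain ⟨C, hC, hU⟩ := hU
  obtain ⟨C', hC', hV⟩ := hV
  refine ⟨C + 2 * (C' + 2 * (C + C') / volume (U ∩ V) * volume V), ?_, fun φ hφ => ?_⟩
  · have := ENNReal.div_ne_top (x := 2 * (C + C')) (by finiteness) hUV
    finiteness
  obtain ⟨c, hc⟩ := hU φ hφ
  obtain ⟨c', hc'⟩ := hV φ hφ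
  set G := ∫⁻ x in D, ‖gradient φ x‖ₑ ^ 2
  have hm : ∀ c : ℝ, Measurable fun x => ‖φ x - c‖ₑ ^ 2 := fun c =>
    (hφ.continuous.sub continuous_const).enorm.measurable.pow_const 2
  have hcc : ‖c' - c‖ₑ ^ 2 ≤ 2 * (C + C') / volume (U ∩ V) * G := by
    have hfin : volume (U ∩ V) ≠ ⊤ := measure_ne_top_of_subset Set.inter_subset_right hVfin
    rw [← ENNReal.mul_div_right_comm, ENNReal.le_div_iff_mul_le (Or.inl hUV) (Or.inl hfin)]
    calc ‖c' - c‖ₑ ^ 2 * volume (U ∩ V) = ∫⁻ x in U ∩ V, ‖c' - c‖ₑ ^ 2 := by simp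
      _ ≤ ∫⁻ x in U ∩ V, 2 * (‖φ x - c‖ₑ ^ 2 + ‖φ x - c'‖ₑ ^ 2) := by
          refine lintegral_mono fun x => ?_
          have := enorm_add_sq_le (φ x - c) (-(φ x - c'))
          rw [enorm_neg] at this
          convert this using 3
          ring
      _ = 2 * ((∫⁻ x in U ∩ V, ‖φ x - c‖ₑ ^ 2) + ∫⁻ x in U ∩ V, ‖φ x - c'‖ₑ ^ 2) := by
          exact lintegral_two_mul_add _ (hm c) (hm c')
      _ ≤ 2 * (C * G + C' * G) := by
          gcongr
          · exact (lintegral_mono_set Set.inter_subset_left).trans hc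
          · exact (lintegral_mono_set Set.inter_subset_right).trans hc'
      _ = 2 * (C + C') * G := by ring
  refine ⟨c, ?_⟩
  calc ∫⁻ x in U ∪ V, ‖φ x - c‖ₑ ^ 2
      ≤ (∫⁻ x in U, ‖φ x - c‖ₑ ^ 2) + ∫⁻ x in V, ‖φ x - c‖ₑ ^ 2 := lintegral_union_le _ _ _
    _ ≤ C * G + ∫⁻ x in V, 2 * (‖φ x - c'‖ₑ ^ 2 + ‖c' - c‖ₑ ^ 2) := by
        gcongr with x
        have := enorm_add_sq_le (φ x - c') (c' - c)
        simpa using this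
    _ = C * G + 2 * ((∫⁻ x in V, ‖φ x - c'‖ₑ ^ 2) + ‖c' - c‖ₑ ^ 2 * volume V) := by
        rw [lintegral_two_mul_add _ (hm c') measurable_const, setLIntegral_const]
    _ ≤ C * G + 2 * (C' * G + 2 * (C + C') / volume (U ∩ V) * G * volume V) := by gcongr
    _ = _ := by ring

/-- The values of `φ` on `S` differ from those on the translate, where the constant is known, by a
gradient integral along segments in `D`. This reaches boundary pieces from an interior ball. -/
lemma HasPoincare.of_translate {D U S : Set (Rd d)} (hU : HasPoincare D U)
    (hUm : MeasurableSet U) (hS : MeasurableSet S) (hD : MeasurableSet D) (w : Rd d)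
    (hSU : ∀ x ∈ S, x + w ∈ U) (hw : ∀ x ∈ S, ∀ t ∈ Set.Ioc (0 : ℝ) 1, x + t • w ∈ D) :
    HasPoincare D S := by
  obtain ⟨C, hC, hU⟩ := hU
  refine ⟨2 * (C + ‖w‖ₑ ^ 2), by finiteness, fun φ hφ => ?_⟩
  obtain ⟨c, hc⟩ := hU φ hφ
  refine ⟨c, ?_⟩
  have hm : Measurable fun x => ‖φ (x + w) - c‖ₑ ^ 2 :=
    ((hφ.continuous.comp (continuous_add_const w)).sub
      continuous_const).enorm.measurable.pow_const 2
  have hm' : Measurable fun x => ‖φ (x + w) - φ x‖ₑ ^ 2 :=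
    ((hφ.continuous.comp (continuous_add_const w)).sub
      hφ.continuous).enorm.measurable.pow_const 2
  calc ∫⁻ x in S, ‖φ x - c‖ₑ ^ 2
      ≤ ∫⁻ x in S, 2 * (‖φ (x + w) - c‖ₑ ^ 2 + ‖φ (x + w) - φ x‖ₑ ^ 2) := by
        refine lintegral_mono fun x => ?_
        have := enorm_add_sq_le (φ (x + w) - c) (-(φ (x + w) - φ x))
        rw [enorm_neg] at this
        convert this using 3
        ring
    _ = 2 * ((∫⁻ x in S, ‖φ (x + w) - c‖ₑ ^ 2) + ∫⁻ x in S, ‖φ (x + w) - φ x‖ₑ ^ 2) := by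
        exact lintegral_two_mul_add _ hm hm'
    _ ≤ 2 * (C * (∫⁻ x in D, ‖gradient φ x‖ₑ ^ 2)
          + ‖w‖ₑ ^ 2 * ∫⁻ x in D, ‖gradient φ x‖ₑ ^ 2) := by
        gcongr
        · refine le_trans ?_ hc
          rw [← lintegral_indicator hS, ← lintegral_indicator hUm,
            ← lintegral_add_right_eq_self (Set.indicator U _) w]
          refine lintegral_mono fun x => ?_
          by_cases hx : x ∈ S
          · simp [hx, hSU x hx]
          · simp [hx]
        · exact lintegral_translate_sub_sq_le hφ hS hD w hw
    _ = _ := by ring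

/-- The double integral of `|φ x - φ y|²` over the ball is rewritten in the displacement `w = x -
y`, of length less than `2r`. For each `w` convexity keeps the segments inside the ball and the
translation estimate applies. -/
lemma hasPoincare_ball {D : Set (Rd d)} (hD : MeasurableSet D) (x₀ : Rd d) {r : ℝ} (hr : 0 < r)
    (hB : Metric.ball x₀ r ⊆ D) : HasPoincare D (Metric.ball x₀ r) := by
  set B := Metric.ball x₀ r with hBdef
  have hBm : MeasurableSet B := measurableSet_ball
  have hB0 : volume B ≠ 0 := (Metric.measure_ball_pos volume x₀ hr).ne'
  have hBfin : volume B ≠ ⊤ := measure_ball_lt_top.ne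
  set W := Metric.ball (0 : Rd d) (2 * r)
  have hWfin : volume W ≠ ⊤ := measure_ball_lt_top.ne
  refine ⟨ENNReal.ofReal (2 * r) ^ 2 * volume W / volume B,
    ENNReal.div_ne_top (by finiteness) hB0, fun φ hφ => ?_⟩
  set G := ∫⁻ x in D, ‖gradient φ x‖ₑ ^ 2
  have hm : Measurable fun p : Rd d × Rd d => ‖φ p.2 - φ p.1‖ₑ ^ 2 :=
    ((hφ.continuous.comp continuous_snd).sub
      (hφ.continuous.comp continuous_fst)).enorm.measurable.pow_const 2
  have hmw : Measurable fun p : Rd d × Rd d =>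
      (B.indicator 1 p.1 * B.indicator 1 (p.1 + p.2)) * ‖φ (p.1 + p.2) - φ p.1‖ₑ ^ 2 := by
    have h1 : Measurable (B.indicator (1 : Rd d → ℝ≥0∞)) := measurable_one.indicator hBm
    have h2 : Measurable fun p : Rd d × Rd d => B.indicator (1 : Rd d → ℝ≥0∞) p.1 :=
      h1.comp measurable_fst
    have h3 : Measurable fun p : Rd d × Rd d => B.indicator (1 : Rd d → ℝ≥0∞) (p.1 + p.2) :=
      h1.comp (measurable_fst.add measurable_snd)
    have h4 : Measurable fun p : Rd d × Rd d => ‖φ (p.1 + p.2) - φ p.1‖ₑ ^ 2 :=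
      ((hφ.continuous.comp (continuous_fst.add continuous_snd)).sub
        (hφ.continuous.comp continuous_fst)).enorm.measurable.pow_const 2
    exact (h2.mul h3).mul h4
  have hdouble : ∫⁻ y in B, ∫⁻ x in B, ‖φ x - φ y‖ₑ ^ 2 ≤
      ENNReal.ofReal (2 * r) ^ 2 * volume W * G := by
    calc ∫⁻ y in B, ∫⁻ x in B, ‖φ x - φ y‖ₑ ^ 2
        = ∫⁻ y, ∫⁻ w, (B.indicator 1 y * B.indicator 1 (y + w)) * ‖φ (y + w) - φ y‖ₑ ^ 2 := by
          rw [← lintegral_indicator hBm]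
          refine lintegral_congr fun y => ?_
          by_cases hy : y ∈ B
          · simp only [hy, Set.indicator_of_mem, Pi.one_apply, one_mul]
            rw [← lintegral_indicator hBm, ← lintegral_add_left_eq_self _ y]
            refine lintegral_congr fun w => ?_
            by_cases hw : y + w ∈ B <;> simp [hw]
          · simp [hy]
      _ = ∫⁻ w, ∫⁻ y, (B.indicator 1 y * B.indicator 1 (y + w)) * ‖φ (y + w) - φ y‖ₑ ^ 2 :=
          lintegral_lintegral_swap hmw.aemeasurable
      _ ≤ ∫⁻ w, W.indicator (fun _ => ENNReal.ofReal (2 * r) ^ 2 * G) w := by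
          refine lintegral_mono fun w => ?_
          by_cases hw : w ∈ W
          · simp only [hw, Set.indicator_of_mem]
            set S := B ∩ (fun y => y + w) ⁻¹' B
            have hS : MeasurableSet S := hBm.inter (measurable_add_const w hBm)
            have h1 : ∀ y ∈ S, ∀ t ∈ Set.Ioc (0 : ℝ) 1, y + t • w ∈ D := fun y hy t ht =>
              hB ((convex_ball x₀ r).add_smul_mem hy.1 hy.2 ⟨ht.1.le, ht.2⟩)
            have hw' : ‖w‖ₑ ≤ ENNReal.ofReal (2 * r) := by
              rw [← ofReal_norm]
              exact ENNReal.ofReal_le_ofReal (mem_ball_zero_iff.1 hw).le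
            refine le_trans ?_ ((lintegral_translate_sub_sq_le hφ hS hD w h1).trans
              (by gcongr))
            rw [← lintegral_indicator hS]
            refine lintegral_mono fun y => ?_
            by_cases h1 : y ∈ B <;> by_cases h2 : y + w ∈ B <;> simp [S, h1, h2]
          · have : ∀ y, B.indicator (1 : Rd d → ℝ≥0∞) y * B.indicator 1 (y + w) = 0 := by
              intro y
              by_contra hne
              have hy : y ∈ B := by
                by_contra h; simp [h] at hne
              have hyw : y + w ∈ B := by
                by_contra h; simp [h] at hne
              apply hw
              rw [mem_ball_zero_iff]
              have h1 := mem_ball_iff_norm.1 hy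
              have h2 := mem_ball_iff_norm.1 hyw
              calc ‖w‖ = ‖(y + w - x₀) - (y - x₀)‖ := by congr 1; abel
                _ ≤ ‖y + w - x₀‖ + ‖y - x₀‖ := norm_sub_le _ _
                _ < 2 * r := by linarith
            simp [this]
      _ = ENNReal.ofReal (2 * r) ^ 2 * volume W * G := by
          rw [lintegral_indicator measurableSet_ball, setLIntegral_const]
          ring
  have hmy : Measurable fun y => ∫⁻ x in B, ‖φ x - φ y‖ₑ ^ 2 := hm.lintegral_prod_right'
  -- Some `y` does no worse than the average; its value `φ y` serves as the constant.
  obtain ⟨y, hy, hle⟩ := exists_le_setLAverage hB0 hBfin hmy.aemeasurable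
  refine ⟨φ y, hle.trans ?_⟩
  rw [setLAverage_eq, ENNReal.div_eq_inv_mul, ENNReal.div_eq_inv_mul, mul_assoc]
  gcongr

/-- Near a boundary point, moving in the direction `e` leads into the domain, and the boundary is
the graph of a Lipschitz function over the hyperplane `eᗮ`. -/
lemma IsLipschitzDomain.exists_chart {D : Set (Rd d)} (hD : IsLipschitzDomain D) {x₀ : Rd d}
    (hx₀ : x₀ ∈ frontier D) :
    ∃ (e : Rd d) (ρ σ : ℝ) (K : ℝ≥0)
      (h : ((Submodule.span ℝ {e})ᗮ : Submodule ℝ (Rd d)) → ℝ),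
      ‖e‖ = 1 ∧ 0 < ρ ∧ 0 < σ ∧ LipschitzWith K h ∧ Metric.ball (x₀ + σ • e) ρ ⊆ D ∧
      (∀ x ∈ Metric.ball x₀ ρ, x ∈ closure D → ∀ t ∈ Set.Ioc 0 σ, x + t • e ∈ D) ∧
      ∀ z ∈ Metric.ball x₀ ρ, z ∈ frontier D →
        ⟪e, z⟫_ℝ = h ((Submodule.span ℝ {e})ᗮ.orthogonalProjectionOnto z) := by
  obtain ⟨e, r, K, h, he, hr, hh, hy⟩ := hD.lipschitz_boundary x₀ hx₀
  set P := (Submodule.span ℝ {e})ᗮ.orthogonalProjectionOnto with hP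
  have hPe : P e = 0 := Submodule.orthogonalProjectionOnto_orthogonalComplement_singleton_eq_zero e
  have hee : ⟪e, e⟫_ℝ = 1 := by rw [real_inner_self_eq_norm_sq, he, one_pow]
  -- The epigraph inequality survives on the closure in non-strict form; a shift by `t • e` with `t
  -- > 0` makes it strict again.
  have hcl : ∀ y ∈ Metric.ball x₀ r, y ∈ closure D → h (P y) ≤ ⟪e, y⟫_ℝ := by
    intro y hyr hyD
    have h1 : y ∈ closure (Metric.ball x₀ r ∩ D) :=
      Metric.isOpen_ball.inter_closure ⟨hyr, hyD⟩
    have h2 : IsClosed {y | h (P y) ≤ ⟪e, y⟫_ℝ} :=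
      isClosed_le (hh.continuous.comp P.continuous) (by fun_prop)
    exact closure_minimal (fun y hy' => ((hy y hy'.1).1 hy'.2).le) h2 h1
  have hfr : ∀ z ∈ Metric.ball x₀ r, z ∈ frontier D → ⟪e, z⟫_ℝ = h (P z) := by
    intro z hzr hz
    refine le_antisymm ?_ (hcl z hzr (frontier_subset_closure hz))
    have : z ∉ D := fun hzD => by
      rw [hD.isOpen.frontier_eq] at hz
      exact hz.2 hzD
    rw [hy z hzr] at this
    exact not_lt.1 this
  have hK : (0 : ℝ) < 1 + K := by positivity
  have hρr : r / 2 / (1 + K) ≤ r / 2 := div_le_self (by positivity) (by simp)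
  -- The point `x₀ + (r / 2) • e` lies at height `r / 2` above the graph. A displacement `v` costs
  -- at most `‖v‖` in height and `K * ‖v‖` in `h`, hence the radius `r / 2 / (1 + K)`; being at most
  -- `r / 2`, it also keeps all points in the chart.
  refine ⟨e, r / 2 / (1 + K), r / 2, K, h, he, by positivity, by positivity, hh, ?_, ?_, ?_⟩
  · intro y hyb
    set v := y - (x₀ + (r / 2) • e) with hv
    have hvn : ‖v‖ < r / 2 / (1 + K) := mem_ball_iff_norm.1 hyb
    have hyv : y = x₀ + (r / 2) • e + v := by rw [hv]; abel
    have hyr : y ∈ Metric.ball x₀ r := by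
      rw [mem_ball_iff_norm, hyv]
      calc ‖x₀ + (r / 2) • e + v - x₀‖ = ‖(r / 2) • e + v‖ := by congr 1; abel
        _ ≤ ‖(r / 2) • e‖ + ‖v‖ := norm_add_le _ _
        _ = r / 2 + ‖v‖ := by rw [norm_smul, he, mul_one, Real.norm_of_nonneg (by positivity)]
        _ < r := by linarith
    rw [hy y hyr]
    have hx := hfr x₀ (Metric.mem_ball_self hr) hx₀
    have h1 : h (P y) ≤ h (P x₀) + K * ‖v‖ := by
      have h2 := hh.dist_le_mul (P y) (P x₀)
      rw [Real.dist_eq, dist_eq_norm, ← map_sub] at h2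
      have h3 : P (y - x₀) = P v := by
        rw [hyv]
        simp [hPe]
      have h4 : ‖P v‖ ≤ ‖v‖ := Submodule.norm_orthogonalProjectionOnto_apply_le _ v
      rw [h3] at h2
      have := (le_abs_self _).trans (h2.trans (mul_le_mul_of_nonneg_left h4 K.2))
      linarith
    have h5 : ⟪e, y⟫_ℝ = ⟪e, x₀⟫_ℝ + r / 2 + ⟪e, v⟫_ℝ := by
      rw [hyv, inner_add_right, inner_add_right, inner_smul_right, hee, mul_one]
    have h6 : -‖v‖ ≤ ⟪e, v⟫_ℝ := by
      have := abs_real_inner_le_norm e v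
      rw [he, one_mul] at this
      exact (abs_le.1 this).1
    rw [lt_div_iff₀ hK] at hvn
    rw [h5]
    linarith
  · intro x hx hxD t ht
    have hx' := mem_ball_iff_norm.1 hx
    have hxr : x ∈ Metric.ball x₀ r := mem_ball_iff_norm.2 (by linarith)
    have hyr : x + t • e ∈ Metric.ball x₀ r := by
      rw [mem_ball_iff_norm]
      calc ‖x + t • e - x₀‖ = ‖(x - x₀) + t • e‖ := by congr 1; abel
        _ ≤ ‖x - x₀‖ + ‖t • e‖ := norm_add_le _ _
        _ = ‖x - x₀‖ + t := by rw [norm_smul, he, mul_one, Real.norm_of_nonneg ht.1.le]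
        _ < r := by linarith [ht.2]
    rw [hy _ hyr]
    have := hcl x hxr hxD
    simp only [map_add, map_smul, hPe, smul_zero, add_zero, inner_add_right, inner_smul_right, hee]
    linarith [ht.1]
  · intro z hz
    exact hfr z (Metric.ball_subset_ball (by linarith) hz)

/-- At a boundary point, the shift by `σ • e` moves the local piece of `D` into a ball inside `D`,
through points of `D`. -/
lemma IsLipschitzDomain.hasPoincare_inter_ball {D : Set (Rd d)} (hD : IsLipschitzDomain D)
    {x : Rd d} (hx : x ∈ closure D) : ∃ ρ > 0, HasPoincare D (D ∩ Metric.ball x ρ) := by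
  have hDm := hD.isOpen.measurableSet
  by_cases hxD : x ∈ D
  · obtain ⟨ρ, hρ, hB⟩ := Metric.isOpen_iff.1 hD.isOpen x hxD
    exact ⟨ρ, hρ, (hasPoincare_ball hDm x hρ hB).mono Set.inter_subset_right⟩
  · have hfr : x ∈ frontier D := by
      rw [hD.isOpen.frontier_eq]
      exact ⟨hx, hxD⟩
    obtain ⟨e, ρ, σ, K, h, he, hρ, hσ, -, hB, hup, -⟩ := hD.exists_chart hfr
    refine ⟨ρ, hρ, (hasPoincare_ball hDm _ hρ hB).of_translate measurableSet_ball
      (hDm.inter measurableSet_ball) hDm (σ • e) (fun y hy => ?_) fun y hy t ht => ?_⟩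
    · have := mem_ball_iff_norm.1 hy.2
      rw [mem_ball_iff_norm]
      simpa using this
    · rw [smul_smul]
      refine hup y hy.2 (subset_closure hy.1) _ ⟨mul_pos ht.1 hσ, ?_⟩
      exact mul_le_of_le_one_left hσ.le ht.2

lemma IsLipschitzDomain.volume_ne_top {D : Set (Rd d)} (hD : IsLipschitzDomain D) :
    volume D ≠ ⊤ := hD.isBounded.measure_lt_top.ne

/-- The Poincaré inequality on a bounded Lipschitz domain. -/
lemma IsLipschitzDomain.hasPoincare {D : Set (Rd d)} (hD : IsLipschitzDomain D) :
    HasPoincare D D := by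
  have hDm := hD.isOpen.measurableSet
  have hunion : ∀ U V : Set (Rd d), IsOpen U → IsOpen V → V ⊆ D → HasPoincare D U →
      HasPoincare D V → (U ∩ V).Nonempty → HasPoincare D (U ∪ V) := by
    intro U V hU hV hVD hPU hPV hne
    exact hPU.union hPV ((hU.inter hV).measure_pos volume hne).ne'
      (measure_ne_top_of_subset hVD hD.volume_ne_top)
  -- Lying in a common open set with a Poincaré inequality is a symmetric and transitive relation
  -- that holds between nearby points, so connectedness extends it to all pairs.
  have hconn : ∀ x ∈ D, ∀ y ∈ D, ∃ U, IsOpen U ∧ U ⊆ D ∧ x ∈ U ∧ y ∈ U ∧ HasPoincare D U := by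
    intro x hx y hy
    refine hD.isConnected.isPreconnected.induction₂
      (fun x y => ∃ U, IsOpen U ∧ U ⊆ D ∧ x ∈ U ∧ y ∈ U ∧ HasPoincare D U) ?_ ?_ ?_ hx hy
    · intro z hz
      obtain ⟨ρ, hρ, hB⟩ := Metric.isOpen_iff.1 hD.isOpen z hz
      filter_upwards [mem_nhdsWithin_of_mem_nhds (Metric.ball_mem_nhds z hρ)] with y hy
      exact ⟨Metric.ball z ρ, Metric.isOpen_ball, hB, Metric.mem_ball_self hρ, hy,
        hasPoincare_ball hDm z hρ hB⟩
    · rintro a b c - - - ⟨U, hU, hUD, haU, hbU, hPU⟩ ⟨V, hV, hVD, hbV, hcV, hPV⟩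
      exact ⟨U ∪ V, hU.union hV, Set.union_subset hUD hVD, Or.inl haU, Or.inr hcV,
        hunion U V hU hV hVD hPU hPV ⟨b, hbU, hbV⟩⟩
    · rintro a b - - ⟨U, hU, hUD, haU, hbU, hPU⟩
      exact ⟨U, hU, hUD, hbU, haU, hPU⟩
  obtain ⟨x₀, hx₀⟩ := hD.isConnected.nonempty
  -- Compactness of `closure D` leaves finitely many pieces. Requiring all of them to contain `x₀`
  -- makes every union one of overlapping open sets.
  have key : ∃ U, IsOpen U ∧ U ⊆ D ∧ x₀ ∈ U ∧ closure D ∩ D ⊆ U ∧ HasPoincare D U := by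
    refine hD.isBounded.isCompact_closure.induction_on
      (p := fun S => ∃ U, IsOpen U ∧ U ⊆ D ∧ x₀ ∈ U ∧ S ∩ D ⊆ U ∧ HasPoincare D U) ?_ ?_ ?_ ?_
    · obtain ⟨U, hU, hUD, h, -, hP⟩ := hconn x₀ hx₀ x₀ hx₀
      exact ⟨U, hU, hUD, h, by simp, hP⟩
    · rintro S T hST ⟨U, hU, hUD, h, hT, hP⟩
      exact ⟨U, hU, hUD, h, (Set.inter_subset_inter_left D hST).trans hT, hP⟩
    · rintro S T ⟨U, hU, hUD, h, hS, hP⟩ ⟨V, hV, hVD, h', hT, hP'⟩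
      refine ⟨U ∪ V, hU.union hV, Set.union_subset hUD hVD, Or.inl h, ?_,
        hunion U V hU hV hVD hP hP' ⟨x₀, h, h'⟩⟩
      rw [Set.union_inter_distrib_right]
      exact Set.union_subset_union hS hT
    · intro x hx
      obtain ⟨ρ, hρ, hP⟩ := hD.hasPoincare_inter_ball hx
      refine ⟨Metric.ball x ρ, mem_nhdsWithin_of_mem_nhds (Metric.ball_mem_nhds x hρ), ?_⟩
      obtain ⟨y, hyB, hyD⟩ := mem_closure_iff_nhds.1 hx _ (Metric.ball_mem_nhds x hρ)
      obtain ⟨U, hU, hUD, h, hyU, hPU⟩ := hconn x₀ hx₀ y hyD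
      refine ⟨U ∪ (D ∩ Metric.ball x ρ), hU.union (hD.isOpen.inter Metric.isOpen_ball),
        Set.union_subset hUD Set.inter_subset_left, Or.inl h, ?_,
        hunion _ _ hU (hD.isOpen.inter Metric.isOpen_ball) Set.inter_subset_left hPU hP
          ⟨y, hyU, hyD, hyB⟩⟩
      rw [Set.inter_comm]
      exact Set.subset_union_right
  obtain ⟨U, -, -, -, hDU, hP⟩ := key
  exact hP.mono fun x hx => hDU ⟨subset_closure hx, hx⟩

/-! ### Surface measure and the trace inequality -/

lemma euclideanHausdorffMeasure_image_le {X Y : Type*} [EMetricSpace X] [MeasurableSpace X]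
    [BorelSpace X] [EMetricSpace Y] [MeasurableSpace Y] [BorelSpace Y] {K : ℝ≥0} {f : X → Y}
    (hf : LipschitzWith K f) (n : ℕ) (s : Set X) :
    μHE[n] (f '' s) ≤ (K : ℝ≥0∞) ^ n * μHE[n] s := by
  have h := hf.hausdorffMeasure_image_le (Nat.cast_nonneg n) s
  rw [ENNReal.rpow_natCast] at h
  simp only [Measure.euclideanHausdorffMeasure_def, Measure.smul_apply, ENNReal.smul_def,
    smul_eq_mul]
  rw [mul_left_comm]
  gcongr

lemma finrank_orthogonal_span_unit {e : Rd d} (he : ‖e‖ = 1) :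
    Module.finrank ℝ ((Submodule.span ℝ {e})ᗮ : Submodule ℝ (Rd d)) = d - 1 := by
  have h := (Submodule.span ℝ {e}).finrank_add_finrank_orthogonal
  have he0 : e ≠ 0 := by
    rintro rfl
    simp at he
  rw [finrank_span_singleton he0, finrank_euclideanSpace_fin] at h
  omega

lemma euclideanHausdorffMeasure_orthogonal_span_unit {e : Rd d} (he : ‖e‖ = 1) :
    (μHE[d - 1] : Measure ((Submodule.span ℝ {e})ᗮ : Submodule ℝ (Rd d))) = volume := by
  rw [← finrank_orthogonal_span_unit he]
  exact InnerProductSpace.euclideanHausdorffMeasure_eq_volume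

/-- Tonelli for the orthogonal splitting into the line of `e`, isometric to `ℝ`, and `eᗮ`. -/
lemma lintegral_orthogonal_span_unit {e : Rd d} (he : ‖e‖ = 1) {F : Rd d → ℝ≥0∞}
    (hF : Measurable F) :
    ∫⁻ w : ((Submodule.span ℝ {e})ᗮ : Submodule ℝ (Rd d)), ∫⁻ t : ℝ, F (w + t • e) =
      ∫⁻ x, F x := by
  set s := Submodule.span ℝ {e}
  have h1 := ((s.measurePreserving_measurableEquivProd (0 : Rd d)).symm).lintegral_comp hF
  rw [InnerProductSpace.euclideanHausdorffMeasure_eq_volume] at h1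
  rw [← h1, Measure.volume_eq_prod, lintegral_prod_symm]
  · refine lintegral_congr fun w => ?_
    have h2 := (LinearIsometryEquiv.toSpanUnitSingleton e he).measurePreserving
    have hm : Measurable fun a : s => F ((s.measurableEquivProd (0 : Rd d)).symm (a, w)) := by
      fun_prop
    rw [← h2.lintegral_comp hm]
    refine lintegral_congr fun t => ?_
    simp [add_comm]
  · exact (hF.comp (MeasurableEquiv.measurable _)).aemeasurable

/-- Integrating over a piece of a Lipschitz graph along short segments transversal to it. -/
lemma lintegral_graph_segment_le {e : Rd d} (he : ‖e‖ = 1) {K : ℝ≥0}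
    {h : ((Submodule.span ℝ {e})ᗮ : Submodule ℝ (Rd d)) → ℝ} (hh : LipschitzWith K h)
    {S D : Set (Rd d)} (hS : MeasurableSet S) (hD : MeasurableSet D) {σ : ℝ}
    (hgraph : ∀ z ∈ S, ⟪e, z⟫_ℝ = h ((Submodule.span ℝ {e})ᗮ.orthogonalProjectionOnto z))
    (hup : ∀ z ∈ S, ∀ t ∈ Set.Ioc 0 σ, z + t • e ∈ D) {f : Rd d → ℝ≥0∞} (hf : Measurable f) :
    ∫⁻ z in S, ∫⁻ t in Set.Ioc 0 σ, f (z + t • e) ∂(volume : Measure ℝ)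
        ∂(μHE[d - 1] : Measure (Rd d)) ≤
      ((1 + K : ℝ≥0) : ℝ≥0∞) ^ (d - 1) * ∫⁻ x in D, f x := by
  set Γ : ((Submodule.span ℝ {e})ᗮ : Submodule ℝ (Rd d)) → Rd d := fun w => w + h w • e with hΓ
  have hΓL : LipschitzWith (1 + K) Γ := by
    refine LipschitzWith.add (LipschitzWith.subtype_val _) ?_
    refine LipschitzWith.of_dist_le_mul fun a b => ?_
    rw [dist_eq_norm, ← sub_smul, norm_smul, he, mul_one]
    simpa [Real.dist_eq] using hh.dist_le_mul a b
  have hΓm : Measurable Γ := hΓL.continuous.measurable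
  have hΓS : ∀ z ∈ S, Γ ((Submodule.span ℝ {e})ᗮ.orthogonalProjectionOnto z) = z := by
    intro z hz
    rw [hΓ]
    simp only
    rw [← hgraph z hz]
    have h1 := Submodule.starProjection_add_starProjection_orthogonal
      (K := Submodule.span ℝ {e}) z
    rw [Submodule.starProjection_unit_singleton ℝ he] at h1
    rw [add_comm]
    exact h1
  -- Each piece of `S` is contained in the image of its parameter set under the `(1 + K)`-Lipschitz
  -- map `Γ`, so surface measure is dominated by a multiple of the pushed-forward Lebesgue measure
  -- of the hyperplane.
  have hle : (μHE[d - 1] : Measure (Rd d)).restrict S ≤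
      ((1 + K : ℝ≥0) : ℝ≥0∞) ^ (d - 1) • (volume.restrict (Γ ⁻¹' S)).map Γ := by
    refine Measure.le_iff.2 fun E hE => ?_
    rw [Measure.restrict_apply hE, Measure.smul_apply, Measure.map_apply hΓm hE,
      Measure.restrict_apply (hΓm hE), smul_eq_mul,
      ← euclideanHausdorffMeasure_orthogonal_span_unit he]
    refine le_trans (measure_mono ?_) (euclideanHausdorffMeasure_image_le hΓL _ _)
    intro z hz
    refine ⟨(Submodule.span ℝ {e})ᗮ.orthogonalProjectionOnto z, ?_, hΓS z hz.2⟩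
    simpa [hΓS z hz.2] using hz
  have hfm : Measurable fun p : Rd d × ℝ => f (p.1 + p.2 • e) := hf.comp (by fun_prop)
  have hHm : Measurable fun z : Rd d => ∫⁻ t in Set.Ioc 0 σ, f (z + t • e) :=
    hfm.lintegral_prod_right'
  refine (lintegral_mono' hle le_rfl).trans ?_
  rw [lintegral_smul_measure, lintegral_map hHm hΓm, smul_eq_mul]
  gcongr
  rw [← lintegral_indicator hD, ← lintegral_orthogonal_span_unit he (hf.indicator hD),
    ← lintegral_indicator (hΓm hS)]
  refine lintegral_mono fun w => ?_
  by_cases hw : w ∈ Γ ⁻¹' S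
  · simp only [hw, Set.indicator_of_mem]
    -- Shifting the height by `h w` places the segment above the graph on the full line over `w`.
    rw [← lintegral_indicator measurableSet_Ioc,
      ← lintegral_add_left_eq_self (fun t : ℝ => D.indicator f (w + t • e)) (h w)]
    refine lintegral_mono fun t => ?_
    by_cases ht : t ∈ Set.Ioc 0 σ
    · have h1 : (w : Rd d) + (h w + t) • e = Γ w + t • e := by
        rw [hΓ, add_smul, add_assoc]
      simp only [ht, Set.indicator_of_mem, h1]
      rw [Set.indicator_of_mem (hup _ hw t ht)]
    · simp [ht]
  · simp [hw]

/-- A boundary value is bounded by the value at `z + t • e` plus the gradient along the segment.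
Averaging over `0 < t ≤ σ` and integrating over the graph produces volume integrals only. -/
lemma IsLipschitzDomain.trace_inter_ball_le {D : Set (Rd d)} (hD : IsLipschitzDomain D)
    {x₀ : Rd d} (hx₀ : x₀ ∈ frontier D) :
    ∃ ρ > 0, ∃ C : ℝ≥0∞, C ≠ ⊤ ∧ ∀ φ : Rd d → ℝ, ContDiff ℝ ∞ φ →
      ∫⁻ z in Metric.ball x₀ ρ ∩ frontier D, ‖φ z‖ₑ ^ 2 ∂(μHE[d - 1] : Measure (Rd d)) ≤
        C * ((∫⁻ x in D, ‖φ x‖ₑ ^ 2) + ∫⁻ x in D, ‖gradient φ x‖ₑ ^ 2) := by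
  obtain ⟨e, ρ, σ, K, h, he, hρ, hσ, hh, -, hup, hgraph⟩ := hD.exists_chart hx₀
  have hDm := hD.isOpen.measurableSet
  have heₑ : ‖e‖ₑ = 1 := by rw [← ofReal_norm, he, ENNReal.ofReal_one]
  set τ := ENNReal.ofReal σ with hτ
  have hτ0 : τ ≠ 0 := by simpa [hτ] using hσ
  have hτt : τ ≠ ⊤ := ENNReal.ofReal_ne_top
  set L : ℝ≥0∞ := ((1 + K : ℝ≥0) : ℝ≥0∞) ^ (d - 1)
  have hLt : L ≠ ⊤ := by finiteness
  refine ⟨ρ, hρ, τ⁻¹ * (L * (2 * (1 + τ ^ 2))), ?_, fun φ hφ => ?_⟩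
  · have := ENNReal.inv_ne_top.2 hτ0
    finiteness
  set S := Metric.ball x₀ ρ ∩ frontier D
  have hS : MeasurableSet S := measurableSet_ball.inter isClosed_frontier.measurableSet
  have hmφ : Measurable fun x => ‖φ x‖ₑ ^ 2 := hφ.continuous.enorm.measurable.pow_const 2
  have hmg : Measurable fun x => ‖gradient φ x‖ₑ ^ 2 :=
    (continuous_gradient hφ).enorm.measurable.pow_const 2
  -- One factor `τ` comes from Cauchy-Schwarz on the segment, the other from the length of the
  -- interval in `t`.
  set f : Rd d → ℝ≥0∞ := fun x => 2 * (‖φ x‖ₑ ^ 2 + τ ^ 2 * ‖gradient φ x‖ₑ ^ 2) with hf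
  have hfm : Measurable f := (hmφ.add (hmg.const_mul _)).const_mul _
  have hpt : ∀ z, τ * ‖φ z‖ₑ ^ 2 ≤ ∫⁻ t in Set.Ioc 0 σ, f (z + t • e) := by
    intro z
    have hcz : Measurable fun t : ℝ => z + t • e := by fun_prop
    have hmφz : Measurable fun t : ℝ => ‖φ (z + t • e)‖ₑ ^ 2 := hmφ.comp hcz
    have hmgz : Measurable fun t : ℝ => ‖gradient φ (z + t • e)‖ₑ ^ 2 := hmg.comp hcz
    set I := ∫⁻ s in Set.Ioc 0 σ, ‖gradient φ (z + s • e)‖ₑ ^ 2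
    calc τ * ‖φ z‖ₑ ^ 2 = ∫⁻ t in Set.Ioc 0 σ, ‖φ z‖ₑ ^ 2 := by
          simp [hτ, mul_comm]
      _ ≤ ∫⁻ t in Set.Ioc 0 σ, 2 * (‖φ (z + t • e)‖ₑ ^ 2 + τ * I) := by
          refine setLIntegral_mono' measurableSet_Ioc fun t ht => ?_
          have h1 := enorm_add_sq_le (φ (z + t • e)) (-(φ (z + t • e) - φ z))
          rw [enorm_neg] at h1
          have h2 := enorm_sub_sq_le_lintegral_gradient hφ z e ht.1.le
          rw [heₑ, one_pow, one_mul] at h2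
          have h3 : φ (z + t • e) + -(φ (z + t • e) - φ z) = φ z := by ring
          rw [h3] at h1
          refine h1.trans ?_
          gcongr
          refine h2.trans ?_
          exact mul_le_mul' (ENNReal.ofReal_le_ofReal ht.2)
            (lintegral_mono_set (Set.Ioc_subset_Ioc_right ht.2))
      _ = 2 * ((∫⁻ t in Set.Ioc 0 σ, ‖φ (z + t • e)‖ₑ ^ 2) + τ ^ 2 * I) := by
          rw [lintegral_two_mul_add _ hmφz measurable_const, setLIntegral_const,
            Real.volume_Ioc, sub_zero]
          ring
      _ = ∫⁻ t in Set.Ioc 0 σ, f (z + t • e) := by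
          rw [hf, lintegral_two_mul_add _ hmφz (hmgz.const_mul _),
            lintegral_const_mul _ hmgz]
  have hmain : τ * ∫⁻ z in S, ‖φ z‖ₑ ^ 2 ∂(μHE[d - 1] : Measure (Rd d)) ≤
      L * ∫⁻ x in D, f x := by
    rw [← lintegral_const_mul _ hmφ]
    refine (lintegral_mono fun z => hpt z).trans
      (lintegral_graph_segment_le he hh hS hDm (fun z hz => hgraph z hz.1 hz.2)
        (fun z hz => hup z hz.1 (frontier_subset_closure hz.2)) hfm)
  have hfle : ∫⁻ x in D, f x ≤
      2 * (1 + τ ^ 2) * ((∫⁻ x in D, ‖φ x‖ₑ ^ 2) + ∫⁻ x in D, ‖gradient φ x‖ₑ ^ 2) := by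
    rw [hf, lintegral_two_mul_add _ hmφ (hmg.const_mul _), lintegral_const_mul _ hmg, mul_assoc]
    gcongr
    rw [add_mul, one_mul, mul_add]
    rw [add_add_add_comm]
    exact add_le_add le_self_add le_add_self
  calc _ = τ⁻¹ * (τ * ∫⁻ z in S, ‖φ z‖ₑ ^ 2 ∂(μHE[d - 1] : Measure (Rd d))) := by
        rw [← mul_assoc, ENNReal.inv_mul_cancel hτ0 hτt, one_mul]
    _ ≤ τ⁻¹ * (L * (2 * (1 + τ ^ 2) *
          ((∫⁻ x in D, ‖φ x‖ₑ ^ 2) + ∫⁻ x in D, ‖gradient φ x‖ₑ ^ 2))) := by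
        gcongr τ⁻¹ * ?_
        exact hmain.trans (by gcongr)
    _ = _ := by ring

/-- The trace inequality on a bounded Lipschitz domain. -/
lemma IsLipschitzDomain.trace_le {D : Set (Rd d)} (hD : IsLipschitzDomain D) :
    ∃ C : ℝ≥0∞, C ≠ ⊤ ∧ ∀ φ : Rd d → ℝ, ContDiff ℝ ∞ φ →
      ∫⁻ z, ‖φ z‖ₑ ^ 2 ∂(surfaceMeasure D) ≤
        C * ((∫⁻ x in D, ‖φ x‖ₑ ^ 2) + ∫⁻ x in D, ‖gradient φ x‖ₑ ^ 2) := by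
  have hcomp : IsCompact (frontier D) :=
    hD.isBounded.isCompact_closure.of_isClosed_subset isClosed_frontier frontier_subset_closure
  have key := hcomp.induction_on
    (p := fun S => ∃ C : ℝ≥0∞, C ≠ ⊤ ∧ ∀ φ : Rd d → ℝ, ContDiff ℝ ∞ φ →
      ∫⁻ z in S ∩ frontier D, ‖φ z‖ₑ ^ 2 ∂(μHE[d - 1] : Measure (Rd d)) ≤
        C * ((∫⁻ x in D, ‖φ x‖ₑ ^ 2) + ∫⁻ x in D, ‖gradient φ x‖ₑ ^ 2))
    ⟨0, by simp, by simp⟩ ?_ ?_ ?_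
  · simpa only [Set.inter_self, surfaceMeasure] using key
  · rintro S T hST ⟨C, hC, h⟩
    exact ⟨C, hC, fun φ hφ =>
      (lintegral_mono_set (Set.inter_subset_inter_left _ hST)).trans (h φ hφ)⟩
  · rintro S T ⟨C, hC, h⟩ ⟨C', hC', h'⟩
    refine ⟨C + C', by finiteness, fun φ hφ => ?_⟩
    rw [Set.union_inter_distrib_right, add_mul]
    exact (lintegral_union_le _ _ _).trans (add_le_add (h φ hφ) (h' φ hφ))
  · intro x hx
    obtain ⟨ρ, hρ, h⟩ := hD.trace_inter_ball_le hx
    exact ⟨Metric.ball x ρ, mem_nhdsWithin_of_mem_nhds (Metric.ball_mem_nhds x hρ), h⟩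

/-- The trace inequality for the constant function 1. -/
lemma IsLipschitzDomain.isFiniteMeasure_surfaceMeasure {D : Set (Rd d)}
    (hD : IsLipschitzDomain D) : IsFiniteMeasure (surfaceMeasure D) := by
  obtain ⟨C, hC, h⟩ := hD.trace_le
  have h1 := h (fun _ => 1) contDiff_const
  have hvol := hD.volume_ne_top
  have hg : ∀ x : Rd d, gradient (fun _ : Rd d => (1 : ℝ)) x = 0 := fun x => by simp [gradient]
  simp only [hg, enorm_one, one_pow, lintegral_one, enorm_zero] at h1
  refine ⟨h1.trans_lt ?_⟩
  simpa using ENNReal.mul_lt_top hC.lt_top hvol.lt_top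

/-- Every line parallel to `e` through a point of the bounded set `D` meets the boundary. The
projection of the boundary to `eᗮ` thus covers the non-empty open projection of `D`, and projecting
does not increase Hausdorff measure. -/
lemma IsLipschitzDomain.surfaceMeasure_ne_zero (hd : 1 ≤ d) {D : Set (Rd d)}
    (hD : IsLipschitzDomain D) : surfaceMeasure D Set.univ ≠ 0 := by
  set e : Rd d := EuclideanSpace.single ⟨0, hd⟩ 1 with hedef
  have he : ‖e‖ = 1 := by simp [hedef]
  set W := (Submodule.span ℝ {e})ᗮ with hW
  set P := W.orthogonalProjectionOnto with hP
  have hPe : P e = 0 := Submodule.orthogonalProjectionOnto_orthogonalComplement_singleton_eq_zero e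
  have hsurj : Function.Surjective P := fun w => ⟨w, by simp [hP]⟩
  have hsub : P '' D ⊆ P '' frontier D := by
    rintro _ ⟨x, hx, rfl⟩
    have hc : Continuous fun t : ℝ => x + t • e := by fun_prop
    set T : Set ℝ := (fun t : ℝ => x + t • e) ⁻¹' D
    have hT0 : T.Nonempty := ⟨0, by simpa [T] using hx⟩
    have hT1 : T ≠ Set.univ := by
      intro hT
      obtain ⟨R, hR⟩ := hD.isBounded.exists_norm_le
      have h1 : x + (‖x‖ + |R| + 1) • e ∈ D := by
        have : (‖x‖ + |R| + 1) ∈ T := hT ▸ Set.mem_univ _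
        exact this
      have h2 := hR _ h1
      have h3 : ‖(‖x‖ + |R| + 1) • e‖ = ‖x‖ + |R| + 1 := by
        rw [norm_smul, he, mul_one, Real.norm_of_nonneg (by positivity)]
      have h4 := norm_sub_le (x + (‖x‖ + |R| + 1) • e) x
      rw [add_sub_cancel_left, h3] at h4
      linarith [le_abs_self R]
    obtain ⟨t, ht⟩ := nonempty_frontier_iff.2 ⟨hT0, hT1⟩
    refine ⟨x + t • e, hc.frontier_preimage_subset D ht, ?_⟩
    simp [hPe]
  have hopen : IsOpen (P '' D) := P.isOpenMap hsurj D hD.isOpen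
  have hpos : 0 < volume (P '' D) := hopen.measure_pos volume (hD.isConnected.nonempty.image P)
  rw [← euclideanHausdorffMeasure_orthogonal_span_unit he] at hpos
  have hlip : LipschitzWith 1 P := Submodule.lipschitzWith_orthogonalProjectionOnto W
  have h1 := (hpos.trans_le (measure_mono hsub)).trans_le
    (euclideanHausdorffMeasure_image_le hlip (d - 1) (frontier D))
  rw [ENNReal.coe_one, one_pow, one_mul] at h1
  rw [surfaceMeasure, Measure.restrict_apply_univ]
  exact h1.ne'

/-! ### Coercivity for zero boundary mean -/

lemma gradient_sub_const (φ : Rd d → ℝ) (c : ℝ) :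
    gradient (fun x => φ x - c) = gradient φ := by
  funext x
  simp [gradient, fderiv_sub_const]

/-- For smooth functions of zero boundary mean, the gradient controls the function in the domain
and on the boundary. -/
lemma IsLipschitzDomain.coercive_of_mean_zero (hd : 1 ≤ d) {D : Set (Rd d)}
    (hD : IsLipschitzDomain D) :
    ∃ C : ℝ≥0∞, C ≠ ⊤ ∧ ∀ φ : Rd d → ℝ, ContDiff ℝ ∞ φ → Integrable φ (surfaceMeasure D) →
      ∫ x, φ x ∂(surfaceMeasure D) = 0 →
      (∫⁻ x in D, ‖φ x‖ₑ ^ 2) + ∫⁻ z, ‖φ z‖ₑ ^ 2 ∂(surfaceMeasure D) ≤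
        C * ∫⁻ x in D, ‖gradient φ x‖ₑ ^ 2 := by
  have := hD.isFiniteMeasure_surfaceMeasure
  obtain ⟨Cp, hCp, hP⟩ := hD.hasPoincare
  obtain ⟨Ct, hCt, hT⟩ := hD.trace_le
  set m := surfaceMeasure D Set.univ with hm
  have hm0 : m ≠ 0 := hD.surfaceMeasure_ne_zero hd
  have hmt : m ≠ ⊤ := measure_ne_top _ _
  have hvol := hD.volume_ne_top
  set Cb := Ct * (Cp + 1) with hCb
  have hCbt : Cb ≠ ⊤ := by finiteness
  have hCm : Cb / m ≠ ⊤ := ENNReal.div_ne_top hCbt hm0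
  refine ⟨2 * (Cp + Cb / m * volume D) + 2 * (Cb + Cb / m * m), by finiteness,
    fun φ hφ hint hmean => ?_⟩
  obtain ⟨c, hc⟩ := hP φ hφ
  set G := ∫⁻ x in D, ‖gradient φ x‖ₑ ^ 2
  have hmeas : Measurable fun x => ‖φ x - c‖ₑ ^ 2 :=
    (hφ.continuous.sub continuous_const).enorm.measurable.pow_const 2
  have hb : ∫⁻ z, ‖φ z - c‖ₑ ^ 2 ∂(surfaceMeasure D) ≤ Cb * G := by
    have h1 := hT (fun x => φ x - c) (hφ.sub contDiff_const)
    rw [gradient_sub_const] at h1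
    refine h1.trans ?_
    rw [hCb, mul_assoc, add_mul, one_mul]
    gcongr
  -- As `φ` has zero boundary mean, the integral of `φ - c` over the boundary is `-m c`; so `hb` and
  -- Cauchy-Schwarz control the Poincaré constant `c` by the gradient.
  have hcc : ‖c‖ₑ ^ 2 ≤ Cb / m * G := by
    have h1 : ‖c‖ₑ * m ≤ ∫⁻ z, ‖φ z - c‖ₑ ∂(surfaceMeasure D) := by
      have h2 : ∫ z, (φ z - c) ∂(surfaceMeasure D) = -(m.toReal * c) := by
        rw [integral_sub hint (integrable_const c), hmean, integral_const, smul_eq_mul, zero_sub]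
        rfl
      have h3 := enorm_integral_le_lintegral_enorm (μ := surfaceMeasure D) fun z => φ z - c
      rw [h2, enorm_neg, enorm_mul, Real.enorm_of_nonneg ENNReal.toReal_nonneg,
        ENNReal.ofReal_toReal hmt, mul_comm] at h3
      exact h3
    have h2 : (‖c‖ₑ * m) ^ 2 ≤ m * (Cb * G) := by
      refine (pow_le_pow_left' h1 2).trans
        ((sq_lintegral_le_measure_mul _ ?_).trans (by gcongr))
      exact (hφ.continuous.sub continuous_const).enorm.measurable.aemeasurable
    rw [← ENNReal.mul_div_right_comm, ENNReal.le_div_iff_mul_le (Or.inl hm0) (Or.inl hmt)]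
    have h3 : m * (‖c‖ₑ ^ 2 * m) ≤ m * (Cb * G) := by
      refine le_trans (le_of_eq ?_) h2
      ring
    exact (ENNReal.mul_le_mul_iff_right hm0 hmt).1 h3
  have hsplit : ∀ μ : Measure (Rd d), ∫⁻ x, ‖φ x‖ₑ ^ 2 ∂μ ≤
      2 * ((∫⁻ x, ‖φ x - c‖ₑ ^ 2 ∂μ) + ‖c‖ₑ ^ 2 * μ Set.univ) := by
    intro μ
    rw [← lintegral_const, ← lintegral_two_mul_add _ hmeas measurable_const]
    refine lintegral_mono fun x => ?_
    simpa using enorm_add_sq_le (φ x - c) c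
  calc _ ≤ 2 * (Cp * G + Cb / m * G * volume D) + 2 * (Cb * G + Cb / m * G * m) := by
        refine add_le_add ((hsplit _).trans ?_) ((hsplit _).trans ?_)
        · rw [Measure.restrict_apply_univ]
          gcongr
        · gcongr
    _ = _ := by ring

/-! ### The Hilbert space of functions, gradients and traces -/

lemma _root_.Continuous.memLp_of_isBounded {E : Type*} [NormedAddCommGroup E]
    {μ : Measure (Rd d)} [IsFiniteMeasure μ] {D : Set (Rd d)}
    (hD : Bornology.IsBounded D) (hμ : ∀ᵐ x ∂μ, x ∈ closure D) {f : Rd d → E}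
    (hf : Continuous f) (p : ℝ≥0∞) : MemLp f p μ := by
  obtain ⟨C, hC⟩ := hD.isCompact_closure.exists_bound_of_continuousOn hf.continuousOn
  exact MemLp.of_bound hf.aestronglyMeasurable C (hμ.mono fun x hx => hC x hx)

lemma IsLipschitzDomain.isFiniteMeasure_restrict {D : Set (Rd d)} (hD : IsLipschitzDomain D) :
    IsFiniteMeasure (volume.restrict D) :=
  ⟨by rw [Measure.restrict_apply_univ]; exact hD.volume_ne_top.lt_top⟩

lemma IsLipschitzDomain.memLp_restrict {E : Type*} [NormedAddCommGroup E] {D : Set (Rd d)}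
    (hD : IsLipschitzDomain D) {f : Rd d → E} (hf : Continuous f) (p : ℝ≥0∞) :
    MemLp f p (volume.restrict D) := by
  have := hD.isFiniteMeasure_restrict
  refine hf.memLp_of_isBounded hD.isBounded ?_ p
  exact (ae_restrict_mem hD.isOpen.measurableSet).mono fun x hx => subset_closure hx

lemma IsLipschitzDomain.memLp_surfaceMeasure {E : Type*} [NormedAddCommGroup E] {D : Set (Rd d)}
    (hD : IsLipschitzDomain D) {f : Rd d → E} (hf : Continuous f) (p : ℝ≥0∞) :
    MemLp f p (surfaceMeasure D) := by
  have := hD.isFiniteMeasure_surfaceMeasure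
  refine hf.memLp_of_isBounded hD.isBounded ?_ p
  exact (ae_restrict_mem isClosed_frontier.measurableSet).mono
    fun x hx => frontier_subset_closure hx

/-- The Hilbert space containing triples of a function, its gradient and its trace. -/
abbrev TripleSpace (D : Set (Rd d)) : Type :=
  WithLp 2 (L2 D × WithLp 2 (L2Vec D × L2Bdry D))

/-- The triple of a function, its gradient and its trace. -/
def triple {D : Set (Rd d)} (f : L2 D) (G : L2Vec D) (γ : L2Bdry D) : TripleSpace D :=
  WithLp.toLp 2 (f, WithLp.toLp 2 (G, γ))

/-- The first component of a triple. -/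
def fnL (D : Set (Rd d)) : TripleSpace D →L[ℝ] L2 D := WithLp.fstL 2 ℝ _ _

/-- The gradient component of a triple. -/
def gradL (D : Set (Rd d)) : TripleSpace D →L[ℝ] L2Vec D :=
  (WithLp.fstL 2 ℝ _ _).comp (WithLp.sndL 2 ℝ _ _)

/-- The trace component of a triple. -/
def bdryL (D : Set (Rd d)) : TripleSpace D →L[ℝ] L2Bdry D :=
  (WithLp.sndL 2 ℝ _ _).comp (WithLp.sndL 2 ℝ _ _)

section Triple

variable {D : Set (Rd d)} (f : L2 D) (G : L2Vec D) (γ : L2Bdry D)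

@[simp] lemma fnL_triple : fnL D (triple f G γ) = f := rfl

@[simp] lemma gradL_triple : gradL D (triple f G γ) = G := rfl

@[simp] lemma bdryL_triple : bdryL D (triple f G γ) = γ := rfl

lemma norm_sq_tripleSpace (p : TripleSpace D) :
    ‖p‖ ^ 2 = ‖fnL D p‖ ^ 2 + (‖gradL D p‖ ^ 2 + ‖bdryL D p‖ ^ 2) := by
  rw [WithLp.prod_norm_sq_eq_of_L2, WithLp.prod_norm_sq_eq_of_L2]
  rfl

lemma continuous_triple :
    Continuous fun q : L2 D × L2Vec D × L2Bdry D => triple q.1 q.2.1 q.2.2 := by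
  unfold triple
  exact (WithLp.prod_continuous_toLp 2 _ _).comp (continuous_fst.prodMk
    ((WithLp.prod_continuous_toLp 2 _ _).comp continuous_snd))

end Triple

lemma enorm_sq_eq_lintegral {X E : Type*} [MeasurableSpace X] {μ : Measure X}
    [NormedAddCommGroup E] (f : Lp E 2 μ) {φ : X → E} (h : f =ᵐ[μ] φ) :
    ‖f‖ₑ ^ 2 = ∫⁻ x, ‖φ x‖ₑ ^ 2 ∂μ := by
  rw [Lp.enorm_def, eLpNorm_congr_ae h]
  simpa using eLpNorm_nnreal_pow_eq_lintegral (μ := μ) (f := φ) (p := 2) (by simp)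

/-- The triple `p` is given by the smooth function `φ`. -/
def IsSmoothTriple {D : Set (Rd d)} (p : TripleSpace D) (φ : Rd d → ℝ) : Prop :=
  ContDiff ℝ ∞ φ ∧ fnL D p =ᵐ[volume.restrict D] φ ∧
    gradL D p =ᵐ[volume.restrict D] gradient φ ∧ bdryL D p =ᵐ[surfaceMeasure D] φ

/-- The triples of smooth functions of zero boundary mean. -/
def smoothMeanZero (D : Set (Rd d)) : Submodule ℝ (TripleSpace D) where
  -- For arbitrary `D` the surface measure may be infinite. Integrability excludes the default value
  -- 0 of the integral and makes the mean additive.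
  carrier := {p | (∃ φ, IsSmoothTriple p φ) ∧ Integrable (bdryL D p) (surfaceMeasure D) ∧
    ∫ x, bdryL D p x ∂(surfaceMeasure D) = 0}
  add_mem' := by
    rintro p q ⟨⟨φ, hφ, h1, h2, h3⟩, hpi, hp⟩ ⟨⟨ψ, hψ, h1', h2', h3'⟩, hqi, hq⟩
    have hb : bdryL D (p + q) =ᵐ[surfaceMeasure D] fun x => bdryL D p x + bdryL D q x := by
      rw [map_add]
      exact Lp.coeFn_add _ _
    refine ⟨⟨fun x => φ x + ψ x, hφ.add hψ, ?_, ?_, ?_⟩, (integrable_congr hb).2 (hpi.add hqi), ?_⟩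
    · rw [map_add]
      filter_upwards [h1, h1', Lp.coeFn_add (fnL D p) (fnL D q)] with x a b c
      rw [c, Pi.add_apply, a, b]
    · rw [map_add]
      filter_upwards [h2, h2', Lp.coeFn_add (gradL D p) (gradL D q)] with x a b c
      rw [c, Pi.add_apply, a, b]
      have hφ' := hφ.differentiable (by simp) x
      have hψ' := hψ.differentiable (by simp) x
      simp [gradient, fderiv_fun_add hφ' hψ']
    · filter_upwards [h3, h3', hb] with x a b c
      rw [c, a, b]
    · rw [integral_congr_ae hb, integral_add hpi hqi, hp, hq, add_zero]
  zero_mem' := by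
    have hb : bdryL D 0 =ᵐ[surfaceMeasure D] fun _ => (0 : ℝ) := by
      rw [map_zero]
      exact Lp.coeFn_zero _ _ _
    refine ⟨⟨fun _ => 0, contDiff_const, ?_, ?_, hb⟩,
      (integrable_congr hb).2 (integrable_zero _ _ _), ?_⟩
    · rw [map_zero]
      exact Lp.coeFn_zero _ _ _
    · rw [map_zero]
      filter_upwards [Lp.coeFn_zero (Rd d) 2 (volume.restrict D)] with x hx
      rw [hx]
      simp [gradient]
    · rw [integral_congr_ae hb, integral_zero]
  smul_mem' := by
    rintro c p ⟨⟨φ, hφ, h1, h2, h3⟩, hpi, hp⟩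
    have hb : bdryL D (c • p) =ᵐ[surfaceMeasure D] fun x => c * bdryL D p x := by
      rw [map_smul]
      exact Lp.coeFn_smul _ _
    refine ⟨⟨fun x => c * φ x, contDiff_const.mul hφ, ?_, ?_, ?_⟩,
      (integrable_congr hb).2 (hpi.const_mul c), ?_⟩
    · rw [map_smul]
      filter_upwards [h1, Lp.coeFn_smul c (fnL D p)] with x a b
      rw [b, Pi.smul_apply, a, smul_eq_mul]
    · rw [map_smul]
      filter_upwards [h2, Lp.coeFn_smul c (gradL D p)] with x a b
      rw [b, Pi.smul_apply, a]
      have hφ' := hφ.differentiable (by simp) x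
      simp [gradient, fderiv_const_mul hφ']
    · filter_upwards [h3, hb] with x a b
      rw [b, a]
    · rw [integral_congr_ae hb, integral_const_mul, hp, mul_zero]

/-- The functions of `H¹(D)` with zero boundary mean, together with their gradients and traces. -/
def sobolevMeanZero (D : Set (Rd d)) : Submodule ℝ (TripleSpace D) :=
  (smoothMeanZero D).topologicalClosure

lemma isClosed_sobolevMeanZero (D : Set (Rd d)) :
    IsClosed (sobolevMeanZero D : Set (TripleSpace D)) :=
  (smoothMeanZero D).isClosed_topologicalClosure

instance (D : Set (Rd d)) : CompleteSpace (sobolevMeanZero D) :=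
  (isClosed_sobolevMeanZero D).completeSpace_coe

/-- A closed condition that holds for the triples of smooth functions of zero boundary mean holds
on all of `sobolevMeanZero D`. -/
lemma sobolevMeanZero_induction {D : Set (Rd d)} {P : TripleSpace D → Prop}
    (hP : IsClosed {p | P p}) (h : ∀ p ∈ smoothMeanZero D, P p) {p : TripleSpace D}
    (hp : p ∈ sobolevMeanZero D) : P p :=
  closure_minimal (s := (smoothMeanZero D : Set (TripleSpace D))) h hP hp

/-- The estimate for smooth functions passes to the closure by continuity; the added 1 accounts for
the gradient's own share of the norm. -/
lemma IsLipschitzDomain.norm_sq_le_grad (hd : 1 ≤ d) {D : Set (Rd d)} (hD : IsLipschitzDomain D) :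
    ∃ C : ℝ, 0 < C ∧ ∀ p ∈ sobolevMeanZero D, ‖p‖ ^ 2 ≤ C * ‖gradL D p‖ ^ 2 := by
  obtain ⟨C, hC, h⟩ := hD.coercive_of_mean_zero hd
  refine ⟨C.toReal + 1, by positivity, fun p hp => ?_⟩
  refine sobolevMeanZero_induction (P := fun p => ‖p‖ ^ 2 ≤ (C.toReal + 1) * ‖gradL D p‖ ^ 2)
    (isClosed_le (by fun_prop) (by fun_prop)) ?_ hp
  rintro p ⟨⟨φ, hφ, h1, h2, h3⟩, hi, hz⟩
  have h4 := h φ hφ ((integrable_congr h3).1 hi) (by rwa [← integral_congr_ae h3])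
  rw [← enorm_sq_eq_lintegral _ h1, ← enorm_sq_eq_lintegral _ h2,
    ← enorm_sq_eq_lintegral _ h3] at h4
  have h5 := ENNReal.toReal_mono (by finiteness) h4
  rw [ENNReal.toReal_add (by finiteness) (by finiteness), ENNReal.toReal_mul,
    ENNReal.toReal_pow, ENNReal.toReal_pow, ENNReal.toReal_pow] at h5
  simp only [toReal_enorm] at h5
  rw [norm_sq_tripleSpace]
  linarith

lemma inner_toLp_eq_integral {X : Type*} [MeasurableSpace X] {μ : Measure X} {φ : X → ℝ}
    (hφ : MemLp φ 2 μ) (f : Lp ℝ 2 μ) : ⟪hφ.toLp φ, f⟫_ℝ = ∫ x, f x * φ x ∂μ := by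
  rw [L2.inner_def]
  refine integral_congr_ae ?_
  filter_upwards [hφ.coeFn_toLp] with x hx
  simp [hx]

lemma inner_eq_integral_mul {X : Type*} [MeasurableSpace X] {μ : Measure X} (f g : Lp ℝ 2 μ) :
    ⟪f, g⟫_ℝ = ∫ x, f x * g x ∂μ := by
  rw [L2.inner_def]
  refine integral_congr_ae (Eventually.of_forall fun x => ?_)
  simp [mul_comm]

lemma inner_toLp_one {X : Type*} [MeasurableSpace X] {μ : Measure X} [IsFiniteMeasure μ]
    (f : Lp ℝ 2 μ) : ⟪(memLp_const (1 : ℝ)).toLp (fun _ : X => (1 : ℝ)), f⟫_ℝ = ∫ x, f x ∂μ := by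
  rw [inner_toLp_eq_integral]
  simp

lemma IsLipschitzDomain.integral_bdryL_eq_zero {D : Set (Rd d)} (hD : IsLipschitzDomain D)
    {p : TripleSpace D} (hp : p ∈ sobolevMeanZero D) :
    ∫ x, bdryL D p x ∂(surfaceMeasure D) = 0 := by
  have := hD.isFiniteMeasure_surfaceMeasure
  rw [← inner_toLp_one]
  refine sobolevMeanZero_induction (P := fun p => ⟪_, bdryL D p⟫_ℝ = 0)
    (isClosed_eq (by fun_prop) continuous_const) ?_ hp
  rintro p ⟨-, -, h⟩
  rwa [inner_toLp_one]

/-- For a fixed test function both sides are inner products with fixed `L²` elements, hence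
continuous. For smooth functions the identity is integration by parts on the whole space, the test
function vanishing off `D`. -/
lemma IsLipschitzDomain.isWeakGradient_of_mem {D : Set (Rd d)} (hD : IsLipschitzDomain D)
    {p : TripleSpace D} (hp : p ∈ sobolevMeanZero D) : IsWeakGradient D (fnL D p) (gradL D p) := by
  intro η hη hηc hηD i
  set e : Rd d := EuclideanSpace.single i 1 with he
  have hDm := hD.isOpen.measurableSet
  have hη' : Continuous fun x => fderiv ℝ η x e :=
    (hη.continuous_fderiv (by simp)).clm_apply continuous_const
  have m1 : MemLp (fun x => fderiv ℝ η x e) 2 (volume.restrict D) := hD.memLp_restrict hη' 2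
  have m2 : MemLp (fun x => η x • e) 2 (volume.restrict D) :=
    hD.memLp_restrict (hη.continuous.smul continuous_const) 2
  have e1 : ∀ f : L2 D, ∫ x in D, f x * fderiv ℝ η x e = ⟪m1.toLp _, f⟫_ℝ :=
    fun f => (inner_toLp_eq_integral m1 f).symm
  have e2 : ∀ G : L2Vec D, ∫ x in D, G x i * η x = ⟪m2.toLp _, G⟫_ℝ := by
    intro G
    rw [L2.inner_def]
    refine integral_congr_ae ?_
    filter_upwards [m2.coeFn_toLp] with x hx
    rw [hx, inner_smul_left, he, EuclideanSpace.inner_single_left]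
    simp [mul_comm]
  rw [e1, e2]
  refine sobolevMeanZero_induction
    (P := fun p => ⟪m1.toLp _, fnL D p⟫_ℝ = -⟪m2.toLp _, gradL D p⟫_ℝ)
    (isClosed_eq (by fun_prop) (by fun_prop)) ?_ hp
  rintro p ⟨⟨φ, hφ, h1, h2, -⟩, -, -⟩
  rw [← e1, ← e2]
  have h3 : ∫ x in D, fnL D p x * fderiv ℝ η x e = ∫ x in D, φ x * fderiv ℝ η x e := by
    refine integral_congr_ae ?_
    filter_upwards [h1] with x hx
    rw [hx]
  have h4 : ∫ x in D, gradL D p x i * η x = ∫ x in D, fderiv ℝ φ x e * η x := by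
    refine integral_congr_ae ?_
    filter_upwards [h2] with x hx
    rw [hx, fderiv_eq_inner_gradient, he, EuclideanSpace.inner_single_right]
    simp
  have hzero : ∀ x, x ∉ D → η x = 0 := fun x hx =>
    image_eq_zero_of_notMem_tsupport fun h => hx (hηD h)
  have hzero' : ∀ x, x ∉ D → fderiv ℝ η x e = 0 := by
    intro x hx
    rw [fderiv_of_notMem_tsupport ℝ fun h => hx (hηD h)]
    rfl
  have hφ' : Continuous fun x => fderiv ℝ φ x e :=
    (hφ.continuous_fderiv (by simp)).clm_apply continuous_const
  rw [h3, h4, setIntegral_eq_integral_of_forall_compl_eq_zero fun x hx => by simp [hzero' x hx],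
    setIntegral_eq_integral_of_forall_compl_eq_zero fun x hx => by simp [hzero x hx]]
  refine integral_mul_fderiv_eq_neg_fderiv_mul_of_integrable ?_ ?_ ?_
    (fun x _ => hφ.differentiable (by simp) x) (fun x _ => hη.differentiable (by simp) x)
  · exact (hφ'.mul hη.continuous).integrable_of_hasCompactSupport hηc.mul_left
  · exact (hφ.continuous.mul hη').integrable_of_hasCompactSupport
      ((hηc.fderiv_apply ℝ e).mul_left)
  · exact (hφ.continuous.mul hη.continuous).integrable_of_hasCompactSupport hηc.mul_left

/-- The element of `H¹(D)` underlying an element of `sobolevMeanZero D`. -/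
def IsLipschitzDomain.toH1 {D : Set (Rd d)} (hD : IsLipschitzDomain D) (p : sobolevMeanZero D) :
    H1 D :=
  ⟨fnL D p, gradL D p, hD.isWeakGradient_of_mem p.2⟩

lemma tendsto_eLpNorm_sub_of_ae_eq {X E : Type*} [MeasurableSpace X] {μ : Measure X}
    [NormedAddCommGroup E] {f : ℕ → Lp E 2 μ} {φ : ℕ → X → E} {g : Lp E 2 μ}
    (h : ∀ n, f n =ᵐ[μ] φ n) :
    Tendsto (fun n => eLpNorm (fun x => φ n x - g x) 2 μ) atTop (𝓝 0) ↔
      Tendsto f atTop (𝓝 g) := by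
  rw [Lp.tendsto_Lp_iff_tendsto_eLpNorm']
  refine iff_of_eq (congrArg (fun F => Tendsto F atTop (𝓝 0)) (funext fun n => ?_))
  refine eLpNorm_congr_ae ?_
  filter_upwards [h n] with x hx
  rw [Pi.sub_apply, hx]

lemma IsLipschitzDomain.isTrace_toH1 {D : Set (Rd d)} (hD : IsLipschitzDomain D)
    (p : sobolevMeanZero D) : IsTrace (hD.toH1 p) (bdryL D p) := by
  obtain ⟨q, hq, hlim⟩ := mem_closure_iff_seq_limit.1
    (show (p : TripleSpace D) ∈ closure (smoothMeanZero D : Set (TripleSpace D)) from p.2)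
  choose φ hφ h1 h2 h3 using fun n => (hq n).1
  refine ⟨φ, hφ, ?_, ?_, ?_⟩
  · exact (tendsto_eLpNorm_sub_of_ae_eq h1).2 (((fnL D).continuous.tendsto _).comp hlim)
  · exact (tendsto_eLpNorm_sub_of_ae_eq h2).2 (((gradL D).continuous.tendsto _).comp hlim)
  · exact (tendsto_eLpNorm_sub_of_ae_eq h3).2 (((bdryL D).continuous.tendsto _).comp hlim)

/-- Subtracting the boundary mean from a function with a trace leads to `sobolevMeanZero D`. -/
lemma IsLipschitzDomain.exists_mem_of_isTrace (hd : 1 ≤ d) {D : Set (Rd d)}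
    (hD : IsLipschitzDomain D) {u : H1 D} {γ : L2Bdry D} (h : IsTrace u γ) :
    ∃ c : ℝ, c * (surfaceMeasure D).real Set.univ = ∫ x, γ x ∂(surfaceMeasure D) ∧
      triple (u.fn - (hD.memLp_restrict (continuous_const (y := c)) 2).toLp (fun _ => c)) u.grad
        (γ - (hD.memLp_surfaceMeasure (continuous_const (y := c)) 2).toLp (fun _ => c)) ∈
        sobolevMeanZero D := by
  have := hD.isFiniteMeasure_surfaceMeasure
  have := hD.isFiniteMeasure_restrict
  obtain ⟨φ, hφ, h1, h2, h3⟩ := h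
  have m1 := fun n => hD.memLp_restrict (hφ n).continuous 2
  have m2 := fun n => hD.memLp_restrict (continuous_gradient (hφ n)) 2
  have m3 := fun n => hD.memLp_surfaceMeasure (hφ n).continuous 2
  have l1 := (tendsto_eLpNorm_sub_of_ae_eq fun n => (m1 n).coeFn_toLp).1 h1
  have l2 := (tendsto_eLpNorm_sub_of_ae_eq fun n => (m2 n).coeFn_toLp).1 h2
  have l3 := (tendsto_eLpNorm_sub_of_ae_eq fun n => (m3 n).coeFn_toLp).1 h3
  set m := (surfaceMeasure D).real Set.univ with hm
  have hm0 : m ≠ 0 := by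
    rw [hm, measureReal_ne_zero_iff]
    exact hD.surfaceMeasure_ne_zero hd
  set one₁ : L2 D := (memLp_const (1 : ℝ)).toLp (fun _ => (1 : ℝ)) with hone₁
  set one₂ : L2Bdry D := (memLp_const (1 : ℝ)).toLp (fun _ => (1 : ℝ)) with hone₂
  have k1 : ∀ c : ℝ, (hD.memLp_restrict (continuous_const (y := c)) 2).toLp (fun _ => c) =
      c • one₁ := by
    intro c
    rw [hone₁, ← MemLp.toLp_const_smul]
    congr 1
    ext x
    simp
  have k2 : ∀ c : ℝ, (hD.memLp_surfaceMeasure (continuous_const (y := c)) 2).toLp (fun _ => c) =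
      c • one₂ := by
    intro c
    rw [hone₂, ← MemLp.toLp_const_smul]
    congr 1
    ext x
    simp
  set mean : L2Bdry D → ℝ := fun g => ⟪one₂, g⟫_ℝ / m with hmean
  have hmeanc : Continuous mean := by
    rw [hmean]
    fun_prop
  refine ⟨mean γ, ?_, ?_⟩
  · rw [hmean]
    simp only
    rw [div_mul_cancel₀ _ hm0, inner_toLp_one]
  rw [k1, k2]
  -- The approximants need not have zero mean, so each is corrected by its own; these means converge
  -- because the mean is continuous on `L²(∂D)`.
  have lmean : Tendsto (fun n => mean ((m3 n).toLp (φ n))) atTop (𝓝 (mean γ)) :=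
    (hmeanc.tendsto _).comp l3
  refine (isClosed_sobolevMeanZero D).mem_of_tendsto
    ((continuous_triple.tendsto (_, _, _)).comp
      ((l1.sub (lmean.smul_const one₁)).prodMk_nhds
        (l2.prodMk_nhds (l3.sub (lmean.smul_const one₂))))) (Eventually.of_forall fun n => ?_)
  refine (smoothMeanZero D).le_topologicalClosure ?_
  set c := mean ((m3 n).toLp (φ n)) with hc
  refine ⟨⟨fun x => φ n x - c, (hφ n).sub contDiff_const, ?_, ?_, ?_⟩, ?_, ?_⟩
  · simp only [Function.comp_apply, fnL_triple]
    rw [← k1]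
    filter_upwards [Lp.coeFn_sub ((m1 n).toLp (φ n)) ((hD.memLp_restrict
      (continuous_const (y := c)) 2).toLp (fun _ => c)), (m1 n).coeFn_toLp,
      (hD.memLp_restrict (continuous_const (y := c)) 2).coeFn_toLp] with x a1 a2 a3
    rw [a1, Pi.sub_apply, a2, a3]
  · simp only [Function.comp_apply, gradL_triple]
    rw [gradient_sub_const]
    exact (m2 n).coeFn_toLp
  · simp only [Function.comp_apply, bdryL_triple]
    rw [← k2]
    filter_upwards [Lp.coeFn_sub ((m3 n).toLp (φ n)) ((hD.memLp_surfaceMeasure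
      (continuous_const (y := c)) 2).toLp (fun _ => c)), (m3 n).coeFn_toLp,
      (hD.memLp_surfaceMeasure (continuous_const (y := c)) 2).coeFn_toLp] with x a1 a2 a3
    rw [a1, Pi.sub_apply, a2, a3]
  · exact (Lp.memLp _).integrable one_le_two
  · rw [← inner_toLp_one]
    simp only [Function.comp_apply, bdryL_triple]
    rw [inner_sub_right, inner_smul_right]
    have h1 : ⟪one₂, one₂⟫_ℝ = m := by
      rw [hone₂, inner_toLp_one, integral_congr_ae (MemLp.coeFn_toLp _)]
      simp [hm]
    rw [h1, hmean]
    simp only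
    rw [div_mul_cancel₀ _ hm0, sub_self]

/-! ### Matrix forms and the Lax-Milgram theorem -/

section Bilin

variable (M : Matrix (Fin d) (Fin d) ℝ) (ξ ξ' η η' : Rd d) (c : ℝ)

lemma bilin_add_left : bilin M (ξ + ξ') η = bilin M ξ η + bilin M ξ' η := by
  simp [bilin, add_dotProduct]

lemma bilin_add_right : bilin M ξ (η + η') = bilin M ξ η + bilin M ξ η' := by
  simp [bilin, Matrix.mulVec_add, dotProduct_add]

lemma bilin_smul_left : bilin M (c • ξ) η = c * bilin M ξ η := by
  simp [bilin, smul_dotProduct]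

lemma bilin_smul_right : bilin M ξ (c • η) = c * bilin M ξ η := by
  simp [bilin, Matrix.mulVec_smul, dotProduct_smul]

variable {M} in
lemma bilin_comm (hM : M.IsSymm) : bilin M ξ η = bilin M η ξ := by
  rw [bilin, bilin, Matrix.dotProduct_mulVec, ← Matrix.mulVec_transpose, hM.eq, dotProduct_comm]

end Bilin

section LaxMilgram

variable {H E F : Type*} [NormedAddCommGroup H] [InnerProductSpace ℝ H]
  [NormedAddCommGroup E] [NormedSpace ℝ E]
  [NormedAddCommGroup F] [InnerProductSpace ℝ F] [CompleteSpace F]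
  (K : Submodule ℝ H) (B : E →L[ℝ] E →L[ℝ] ℝ) (G : H →L[ℝ] E)

/-- The form `(p, q) ↦ B (G p) (G q)` is coercive on `K`. -/
def IsCoerciveOn : Prop := ∃ C, 0 < C ∧ ∀ p ∈ K, C * ‖p‖ ^ 2 ≤ B (G p) (G p)

variable {K B G}

lemma IsCoerciveOn.isCoercive (h : IsCoerciveOn K B G) :
    IsCoercive (B.bilinearComp (G.comp K.subtypeL) (G.comp K.subtypeL)) := by
  obtain ⟨C, hC, h⟩ := h
  refine ⟨C, hC, fun p => ?_⟩
  rw [mul_assoc, ← sq]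
  exact h p p.2

variable [CompleteSpace K]

/-- The solution `u ∈ K` of `B (G u) (G w) = ⟪g, π w⟫` for all `w ∈ K`. -/
def IsCoerciveOn.solve (h : IsCoerciveOn K B G) (π : H →L[ℝ] F) : F →L[ℝ] H :=
  -- The adjoint of `π` on `K` turns `g` into the Riesz representative of `w ↦ ⟪g, π w⟫`, to which
  -- the inverse Lax-Milgram isomorphism is applied.
  K.subtypeL.comp ((h.isCoercive.continuousLinearEquivOfBilin.symm : K →L[ℝ] K).comp
    (ContinuousLinearMap.adjoint (π.comp K.subtypeL)))

lemma IsCoerciveOn.solve_mem (h : IsCoerciveOn K B G) (π : H →L[ℝ] F) (g : F) :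
    h.solve π g ∈ K := Subtype.prop _

lemma IsCoerciveOn.apply_solve (h : IsCoerciveOn K B G) (π : H →L[ℝ] F) (g : F) {w : H}
    (hw : w ∈ K) : B (G (h.solve π g)) (G w) = ⟪g, π w⟫_ℝ := by
  have h1 := h.isCoercive.continuousLinearEquivOfBilin_apply
    (h.isCoercive.continuousLinearEquivOfBilin.symm
      (ContinuousLinearMap.adjoint (π.comp K.subtypeL) g)) ⟨w, hw⟩
  rw [ContinuousLinearEquiv.apply_symm_apply, ContinuousLinearMap.adjoint_inner_left] at h1
  exact h1.symm

/-- The difference of two solutions is tested with itself and vanishes by coercivity. -/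
lemma IsCoerciveOn.eq_solve (h : IsCoerciveOn K B G) (π : H →L[ℝ] F) {g : F} {u : H}
    (hu : u ∈ K) (huw : ∀ w ∈ K, B (G u) (G w) = ⟪g, π w⟫_ℝ) : u = h.solve π g := by
  have hmem := h.solve_mem π g
  have h1 := huw _ (K.sub_mem hu hmem)
  have h2 := h.apply_solve π g (K.sub_mem hu hmem)
  have h0 : B (G (u - h.solve π g)) (G (u - h.solve π g)) = 0 := by
    rw [map_sub G u, map_sub B, sub_apply, ← map_sub G, h1, h2, sub_self]
  obtain ⟨C, hC, hco⟩ := h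
  have h3 := hco _ (K.sub_mem hu hmem)
  rw [h0] at h3
  have h4 : ‖u - IsCoerciveOn.solve ⟨C, hC, hco⟩ π g‖ ^ 2 ≤ 0 := nonpos_of_mul_nonpos_right h3 hC
  rw [← sub_eq_zero, ← norm_eq_zero]
  exact pow_eq_zero_iff two_ne_zero |>.1 (le_antisymm h4 (sq_nonneg _))

end LaxMilgram

/-! ### The energy form and the Neumann-to-Dirichlet operator -/

section EnergyForm

variable {D : Set (Rd d)} {α β : ℝ} {A : Rd d → Matrix (Fin d) (Fin d) ℝ}

lemma IsCoeffField.aestronglyMeasurable_bilin (hA : IsCoeffField D α β A) (p q : L2Vec D) :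
    AEStronglyMeasurable (fun x => bilin (A x) (p x) (q x)) (volume.restrict D) := by
  have hcoord : ∀ (p : L2Vec D) (i : Fin d),
      AEMeasurable (fun x => p x i) (volume.restrict D) := fun p i =>
    (show Measurable fun v : Rd d => v i by fun_prop).comp_aemeasurable
      (Lp.aestronglyMeasurable p).aemeasurable
  refine AEMeasurable.aestronglyMeasurable ?_
  simp only [bilin, dotProduct, Matrix.mulVec]
  refine Finset.aemeasurable_fun_sum _ fun i _ => (hcoord p i).mul ?_
  exact Finset.aemeasurable_fun_sum _ fun j _ => (hA.1 i j).mul (hcoord q j)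

lemma integrable_norm_mul_norm (p q : L2Vec D) :
    Integrable (fun x => ‖p x‖ * ‖q x‖) (volume.restrict D) :=
  (Lp.memLp p).norm.integrable_mul (Lp.memLp q).norm

lemma IsCoeffField.integrable_bilin (hA : IsCoeffField D α β A) (p q : L2Vec D) :
    Integrable (fun x => bilin (A x) (p x) (q x)) (volume.restrict D) := by
  refine ((integrable_norm_mul_norm p q).const_mul β).mono' (hA.aestronglyMeasurable_bilin p q) ?_
  filter_upwards [hA.2] with x hx
  rw [← mul_assoc]
  exact hx.2.2 _ _

lemma integral_norm_mul_norm_le (p q : L2Vec D) :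
    ∫ x in D, ‖p x‖ * ‖q x‖ ≤ ‖p‖ * ‖q‖ := by
  have h := real_inner_le_norm ((Lp.memLp p).norm.toLp _) ((Lp.memLp q).norm.toLp _)
  rw [inner_eq_integral_mul, Lp.norm_toLp, Lp.norm_toLp, eLpNorm_norm, eLpNorm_norm,
    ← Lp.norm_def, ← Lp.norm_def] at h
  refine le_trans (le_of_eq (integral_congr_ae ?_)) h
  filter_upwards [(Lp.memLp p).norm.coeFn_toLp, (Lp.memLp q).norm.coeFn_toLp] with x a b
  rw [a, b]

/-- The bilinear form `(p, q) ↦ ∫_D pᵀ A q`. -/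
def energyForm (hβ : 0 < β) (hA : IsCoeffField D α β A) : L2Vec D →L[ℝ] L2Vec D →L[ℝ] ℝ :=
  LinearMap.mkContinuous₂
    (LinearMap.mk₂ ℝ (fun p q : L2Vec D => ∫ x in D, bilin (A x) (p x) (q x))
      (fun p p' q => by
        rw [← integral_add (hA.integrable_bilin p q) (hA.integrable_bilin p' q)]
        refine integral_congr_ae ?_
        filter_upwards [Lp.coeFn_add p p'] with x hx
        rw [hx, Pi.add_apply, bilin_add_left])
      (fun c p q => by
        rw [smul_eq_mul, ← integral_const_mul]
        refine integral_congr_ae ?_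
        filter_upwards [Lp.coeFn_smul c p] with x hx
        rw [hx, Pi.smul_apply, bilin_smul_left])
      (fun p q q' => by
        rw [← integral_add (hA.integrable_bilin p q) (hA.integrable_bilin p q')]
        refine integral_congr_ae ?_
        filter_upwards [Lp.coeFn_add q q'] with x hx
        rw [hx, Pi.add_apply, bilin_add_right])
      (fun c p q => by
        rw [smul_eq_mul, ← integral_const_mul]
        refine integral_congr_ae ?_
        filter_upwards [Lp.coeFn_smul c q] with x hx
        rw [hx, Pi.smul_apply, bilin_smul_right]))
    β (fun p q => by
      rw [LinearMap.mk₂_apply, mul_assoc]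
      refine le_trans ?_ (mul_le_mul_of_nonneg_left (integral_norm_mul_norm_le p q) hβ.le)
      rw [← integral_const_mul]
      refine norm_integral_le_of_norm_le ((integrable_norm_mul_norm p q).const_mul β) ?_
      filter_upwards [hA.2] with x hx
      rw [← mul_assoc]
      exact hx.2.2 _ _)

variable (hβ : 0 < β) (hA : IsCoeffField D α β A)

lemma energyForm_apply (p q : L2Vec D) :
    energyForm hβ hA p q = ∫ x in D, bilin (A x) (p x) (q x) := rfl

lemma energyForm_comm (p q : L2Vec D) : energyForm hβ hA p q = energyForm hβ hA q p := by
  rw [energyForm_apply, energyForm_apply]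
  refine integral_congr_ae ?_
  filter_upwards [hA.2] with x hx
  exact bilin_comm _ _ hx.1

lemma le_energyForm_self (p : L2Vec D) : α * ‖p‖ ^ 2 ≤ energyForm hβ hA p p := by
  rw [energyForm_apply, ← real_inner_self_eq_norm_sq, L2.inner_def, ← integral_const_mul]
  refine integral_mono_ae ((L2.integrable_inner p p).const_mul α) (hA.integrable_bilin p p) ?_
  filter_upwards [hA.2] with x hx
  rw [real_inner_self_eq_norm_sq]
  exact hx.2.1 _

lemma isCoerciveOn_energyForm (hd : 1 ≤ d) (hD : IsLipschitzDomain D) (hα : 0 < α) :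
    IsCoerciveOn (sobolevMeanZero D) (energyForm hβ hA) (gradL D) := by
  obtain ⟨C, hC, h⟩ := hD.norm_sq_le_grad hd
  refine ⟨α / C, div_pos hα hC, fun p hp => ?_⟩
  refine le_trans ?_ (le_energyForm_self hβ hA _)
  rw [div_mul_eq_mul_div, div_le_iff₀ hC, mul_assoc, mul_comm _ C]
  exact mul_le_mul_of_nonneg_left (h p hp) hα.le

variable (hd : 1 ≤ d) (hD : IsLipschitzDomain D) (hα : 0 < α)

/-- The solution operator of the Neumann problem. -/
def neumannSolve : L2Bdry D →L[ℝ] TripleSpace D :=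
  (isCoerciveOn_energyForm hβ hA hd hD hα).solve (bdryL D)

lemma neumannSolve_mem (g : L2Bdry D) : neumannSolve hβ hA hd hD hα g ∈ sobolevMeanZero D :=
  (isCoerciveOn_energyForm hβ hA hd hD hα).solve_mem (bdryL D) g

/-- The Neumann-to-Dirichlet operator. -/
def neumannToDirichlet : L2Bdry D →L[ℝ] L2Bdry D :=
  (bdryL D).comp (neumannSolve hβ hA hd hD hα)

lemma energyForm_neumannSolve (g : L2Bdry D) {w : TripleSpace D} (hw : w ∈ sobolevMeanZero D) :
    energyForm hβ hA (gradL D (neumannSolve hβ hA hd hD hα g)) (gradL D w) = ⟪g, bdryL D w⟫_ℝ :=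
  (isCoerciveOn_energyForm hβ hA hd hD hα).apply_solve (bdryL D) g hw

/-- The equation for the datum `f` is tested with the solution for `g`. This yields both the
symmetry of the operator and, for `f = g`, the energy. -/
lemma inner_neumannToDirichlet (f g : L2Bdry D) :
    ⟪f, neumannToDirichlet hβ hA hd hD hα g⟫_ℝ =
      energyForm hβ hA (gradL D (neumannSolve hβ hA hd hD hα f))
        (gradL D (neumannSolve hβ hA hd hD hα g)) :=
  (energyForm_neumannSolve hβ hA hd hD hα f (neumannSolve_mem hβ hA hd hD hα g)).symm

lemma inner_neumannToDirichlet_comm (f g : L2Bdry D) :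
    ⟪f, neumannToDirichlet hβ hA hd hD hα g⟫_ℝ = ⟪neumannToDirichlet hβ hA hd hD hα f, g⟫_ℝ := by
  rw [inner_neumannToDirichlet, energyForm_comm, ← inner_neumannToDirichlet, real_inner_comm]

/-- Lax-Milgram only covers test functions of zero boundary mean. A general one differs from such a
function by a constant, which has no gradient and pairs to zero with `g`. -/
lemma isSolution_neumannSolve {g : L2Bdry D} (hg : g ∈ L2BdryMean D) :
    IsSolution D A g (hD.toH1 ⟨_, neumannSolve_mem hβ hA hd hD hα g⟩)
      (neumannToDirichlet hβ hA hd hD hα g) := by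
  have := hD.isFiniteMeasure_surfaceMeasure
  refine ⟨hD.isTrace_toH1 _, hD.integral_bdryL_eq_zero (neumannSolve_mem hβ hA hd hD hα g), fun v τ hv => ?_⟩
  obtain ⟨c, -, hmem⟩ := hD.exists_mem_of_isTrace hd hv
  have h := energyForm_neumannSolve hβ hA hd hD hα g hmem
  rw [energyForm_comm] at h
  have h2 : ⟪g, (hD.memLp_surfaceMeasure (continuous_const (y := c)) 2).toLp (fun _ => c)⟫_ℝ
      = 0 := by
    rw [real_inner_comm, inner_toLp_eq_integral, integral_mul_const,
      show ∫ x, g x ∂(surfaceMeasure D) = 0 from hg, zero_mul]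
  calc _ = ⟪g, τ - (hD.memLp_surfaceMeasure (continuous_const (y := c)) 2).toLp (fun _ => c)⟫_ℝ := h
    _ = _ := by rw [inner_sub_right, h2, sub_zero, inner_eq_integral_mul]

/-- The trace of a solution has zero mean and the surface measure is non-zero, so the correcting
constant vanishes. The triple itself then lies in `sobolevMeanZero D`, where `eq_solve` gives
uniqueness. -/
lemma eq_neumannSolve_of_isSolution {g : L2Bdry D} {u : H1 D} {γ : L2Bdry D}
    (h : IsSolution D A g u γ) :
    u = hD.toH1 ⟨_, neumannSolve_mem hβ hA hd hD hα g⟩ ∧ γ = neumannToDirichlet hβ hA hd hD hα g := by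
  have := hD.isFiniteMeasure_surfaceMeasure
  obtain ⟨htr, hmean, heq⟩ := h
  obtain ⟨c, hc, hmem⟩ := hD.exists_mem_of_isTrace hd htr
  have hc0 : c = 0 := by
    rw [hmean] at hc
    refine (mul_eq_zero.1 hc).resolve_right ?_
    rw [← ne_eq, measureReal_ne_zero_iff]
    exact hD.surfaceMeasure_ne_zero hd
  subst hc0
  have hmem' : triple u.fn u.grad γ ∈ sobolevMeanZero D := by
    have z1 : (hD.memLp_restrict (continuous_const (y := (0 : ℝ))) 2).toLp (fun _ => (0 : ℝ)) = 0 :=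
      MemLp.toLp_zero _
    have z2 : (hD.memLp_surfaceMeasure (continuous_const (y := (0 : ℝ))) 2).toLp
        (fun _ => (0 : ℝ)) = 0 := MemLp.toLp_zero _
    rwa [z1, z2, sub_zero, sub_zero] at hmem
  have hsol : triple u.fn u.grad γ = neumannSolve hβ hA hd hD hα g := by
    refine (isCoerciveOn_energyForm hβ hA hd hD hα).eq_solve (bdryL D) hmem' fun w hw => ?_
    rw [energyForm_comm, inner_eq_integral_mul]
    exact heq (hD.toH1 ⟨w, hw⟩) (bdryL D w) (hD.isTrace_toH1 ⟨w, hw⟩)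
  constructor
  · simp only [IsLipschitzDomain.toH1, ← hsol]
    rfl
  · rw [neumannToDirichlet, ContinuousLinearMap.comp_apply, ← hsol]
    rfl

lemma isWellPosed (hβ : 0 < β) (hA : IsCoeffField D α β A) (hd : 1 ≤ d)
    (hD : IsLipschitzDomain D) (hα : 0 < α) : IsWellPosed D A := by
  intro g hg
  refine ⟨(hD.toH1 ⟨_, neumannSolve_mem hβ hA hd hD hα g⟩, neumannToDirichlet hβ hA hd hD hα g),
    isSolution_neumannSolve hβ hA hd hD hα hg, ?_⟩
  rintro ⟨u, γ⟩ h
  obtain ⟨h1, h2⟩ := eq_neumannSolve_of_isSolution hβ hA hd hD hα h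
  exact Prod.ext h1 h2

lemma solution_eq {g : L2Bdry D} (hg : g ∈ L2BdryMean D) :
    solution D A g =
      (hD.toH1 ⟨_, neumannSolve_mem hβ hA hd hD hα g⟩, neumannToDirichlet hβ hA hd hD hα g) := by
  have h : IsSolution D A g (solution D A g).1 (solution D A g).2 :=
    Classical.epsilon_spec (p := fun p : H1 D × L2Bdry D => IsSolution D A g p.1 p.2)
      ⟨(_, _), isSolution_neumannSolve hβ hA hd hD hα hg⟩
  obtain ⟨h1, h2⟩ := eq_neumannSolve_of_isSolution hβ hA hd hD hα h
  exact Prod.ext h1 h2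

/-- The quadratic term and the boundary term both equal `⟪g, T g⟫` for the solution, and `½ - 1 =
-½`. -/
lemma energy_eq {g : L2Bdry D} (hg : g ∈ L2BdryMean D) :
    energy D A g = -(1 / 2) * ⟪g, neumannToDirichlet hβ hA hd hD hα g⟫_ℝ := by
  have h := inner_neumannToDirichlet hβ hA hd hD hα g g
  rw [energy, solution_eq hβ hA hd hD hα hg, ← inner_eq_integral_mul]
  have h1 : ∫ x in D, bilin (A x) ((hD.toH1 ⟨_, neumannSolve_mem hβ hA hd hD hα g⟩).grad x)
      ((hD.toH1 ⟨_, neumannSolve_mem hβ hA hd hD hα g⟩).grad x) =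
      ⟪g, neumannToDirichlet hβ hA hd hD hα g⟫_ℝ := h.symm
  rw [h1]
  ring

lemma neumannToDirichlet_mem (g : L2Bdry D) :
    neumannToDirichlet hβ hA hd hD hα g ∈ L2BdryMean D :=
  hD.integral_bdryL_eq_zero (neumannSolve_mem hβ hA hd hD hα g)

end EnergyForm

/-! ### Quadratic form and norm of a symmetric operator; conclusion -/

/-- `L²_m(∂D)` as a subspace. -/
def meanZeroSubmodule {D : Set (Rd d)} (hD : IsLipschitzDomain D) : Submodule ℝ (L2Bdry D) :=
  haveI := hD.isFiniteMeasure_surfaceMeasure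
  -- Zero mean is orthogonality to 1; `copy` makes the carrier definitionally `L2BdryMean D`.
  (LinearMap.ker (innerₗ (L2Bdry D) ((memLp_const (1 : ℝ)).toLp fun _ => (1 : ℝ)))).copy
    (L2BdryMean D) (by
      ext g
      simp only [SetLike.mem_coe, LinearMap.mem_ker, innerₗ_apply_apply]
      rw [inner_toLp_one]
      rfl)

/-- For a symmetric operator with values in `M`, the suprema of the quadratic form and of the norm
over the unit sphere of `M` agree. -/
lemma bddAbove_and_sSup_eq {H : Type*} [NormedAddCommGroup H] [InnerProductSpace ℝ H]
    (M : Submodule ℝ H) (S : H →L[ℝ] H) (hS : ∀ f g, ⟪f, S g⟫_ℝ = ⟪S f, g⟫_ℝ)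
    (hSM : ∀ g, S g ∈ M) :
    BddAbove ((fun g => |(1 / 2) * ⟪g, S g⟫_ℝ|) '' {g | g ∈ M ∧ ‖g‖ = 1}) ∧
    BddAbove ((fun g => ‖S g‖) '' {g | g ∈ M ∧ ‖g‖ = 1}) ∧
    sSup ((fun g => |(1 / 2) * ⟪g, S g⟫_ℝ|) '' {g | g ∈ M ∧ ‖g‖ = 1}) =
      (1 / 2) * sSup ((fun g => ‖S g‖) '' {g | g ∈ M ∧ ‖g‖ = 1}) := by
  set U := {g | g ∈ M ∧ ‖g‖ = 1}
  have habs : ∀ g, |(1 / 2) * ⟪g, S g⟫_ℝ| = (1 / 2) * |⟪g, S g⟫_ℝ| := fun g => by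
    rw [abs_mul, abs_of_pos (by norm_num : (0 : ℝ) < 1 / 2)]
  have hle : ∀ g ∈ U, |(1 / 2) * ⟪g, S g⟫_ℝ| ≤ (1 / 2) * ‖S g‖ := by
    intro g hg
    have := abs_real_inner_le_norm g (S g)
    rw [hg.2, one_mul] at this
    rw [habs]
    linarith
  have hb : BddAbove ((fun g => ‖S g‖) '' U) := by
    refine ⟨‖S‖, ?_⟩
    rintro _ ⟨g, hg, rfl⟩
    simpa [hg.2] using S.le_opNorm g
  have hb' : BddAbove ((fun g => |(1 / 2) * ⟪g, S g⟫_ℝ|) '' U) := by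
    obtain ⟨R, hR⟩ := hb
    refine ⟨(1 / 2) * R, ?_⟩
    rintro _ ⟨g, hg, rfl⟩
    exact (hle g hg).trans (by linarith [hR ⟨g, hg, rfl⟩])
  refine ⟨hb', hb, ?_⟩
  -- If the unit sphere is empty, both suprema take the default value 0.
  rcases U.eq_empty_or_nonempty with hU | hU
  · simp [hU]
  set R := sSup ((fun g => |(1 / 2) * ⟪g, S g⟫_ℝ|) '' U)
  have hR0 : 0 ≤ R := by
    obtain ⟨g, hg⟩ := hU
    exact (abs_nonneg _).trans (le_csSup hb' ⟨g, hg, rfl⟩)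
  have hquad : ∀ f ∈ M, |⟪f, S f⟫_ℝ| ≤ 2 * R * ‖f‖ ^ 2 := by
    intro f hf
    rcases eq_or_ne f 0 with rfl | hf0
    · simp
    have hn : ‖f‖ ≠ 0 := norm_ne_zero_iff.2 hf0
    have hfU : ‖f‖⁻¹ • f ∈ U := ⟨M.smul_mem _ hf, by
      rw [norm_smul, norm_inv, norm_norm, inv_mul_cancel₀ hn]⟩
    have h1 : |(1 / 2) * ⟪‖f‖⁻¹ • f, S (‖f‖⁻¹ • f)⟫_ℝ| ≤ R := le_csSup hb' ⟨_, hfU, rfl⟩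
    rw [habs, map_smul, inner_smul_left, inner_smul_right, conj_trivial, ← mul_assoc, abs_mul,
      abs_of_nonneg (by positivity)] at h1
    have h2 : |⟪f, S f⟫_ℝ| = ‖f‖ ^ 2 * (‖f‖⁻¹ * ‖f‖⁻¹ * |⟪f, S f⟫_ℝ|) := by
      field_simp
    rw [h2]
    nlinarith [sq_nonneg ‖f‖]
  refine le_antisymm (csSup_le (hU.image _) ?_) ?_
  · rintro _ ⟨g, hg, rfl⟩
    exact (hle g hg).trans (by linarith [le_csSup hb ⟨g, hg, rfl⟩])
  · have h1 : sSup ((fun g => ‖S g‖) '' U) ≤ 2 * R := by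
      refine csSup_le (hU.image _) ?_
      rintro _ ⟨g, hg, rfl⟩
      rcases eq_or_ne (S g) 0 with h0 | h0
      · simp only [h0, norm_zero]
        positivity
      have hn : ‖S g‖ ≠ 0 := norm_ne_zero_iff.2 h0
      -- The unit vector along `S g` lies in `M` because `S` maps into `M`. Polarization with `f ±
      -- g` gives `4 ‖S g‖` by symmetry, and the parallelogram law bounds it by `2 R * 4`.
      set f := ‖S g‖⁻¹ • S g with hf
      have hfM : f ∈ M := M.smul_mem _ (hSM g)
      have hf1 : ‖f‖ = 1 := by rw [hf, norm_smul, norm_inv, norm_norm, inv_mul_cancel₀ hn]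
      have hfg : ⟪f, S g⟫_ℝ = ‖S g‖ := by
        rw [hf, inner_smul_left, conj_trivial, real_inner_self_eq_norm_sq]
        field_simp
      have h2 := (le_abs_self _).trans (hquad (f + g) (M.add_mem hfM hg.1))
      have h3 := (neg_le_abs _).trans (hquad (f - g) (M.sub_mem hfM hg.1))
      have h4 := parallelogram_law_with_norm ℝ f g
      rw [hf1, hg.2] at h4
      have h5 : ⟪f + g, S (f + g)⟫_ℝ + -⟪f - g, S (f - g)⟫_ℝ = 4 * ‖S g‖ := by
        have h6 : ⟪g, S f⟫_ℝ = ‖S g‖ := by rw [hS, real_inner_comm, hfg]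
        simp only [map_add, map_sub, inner_add_left, inner_add_right, inner_sub_left,
          inner_sub_right, hfg, h6]
        ring
      have h7 : 2 * R * ‖f + g‖ ^ 2 + 2 * R * ‖f - g‖ ^ 2 = 2 * R * 4 := by
        rw [← mul_add]
        congr 1
        linarith
      simp only
      linarith
    linarith

lemma isCoeffField_const {α β : ℝ} {M : Matrix (Fin d) (Fin d) ℝ} (hM : M ∈ coeffSet d α β)
    (D : Set (Rd d)) : IsCoeffField D α β fun _ => M :=
  ⟨fun _ _ => aemeasurable_const, Eventually.of_forall fun _ => hM⟩

end NeumannHom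

end

theorem proposition4 {d : ℕ} (hd : 1 ≤ d) (D : Set (NeumannHom.Rd d))
    (hD : NeumannHom.IsLipschitzDomain D) (α β : ℝ) (hα : 0 < α) (hβ : 0 < β)
    (Aeps : ℝ → NeumannHom.Rd d → Matrix (Fin d) (Fin d) ℝ)
    (hAeps : ∀ ε : ℝ, 0 < ε → NeumannHom.IsCoeffField D α β (Aeps ε)) :
    ∀ ε : ℝ, 0 < ε → ∀ Abar ∈ NeumannHom.coeffSet d α β,
      NeumannHom.IsWellPosed D (Aeps ε) ∧
      NeumannHom.IsWellPosed D (fun _ => Abar) ∧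
      BddAbove (NeumannHom.valuesME D (Aeps ε) fun _ => Abar) ∧
      BddAbove (NeumannHom.valuesMS D (Aeps ε) fun _ => Abar) ∧
      NeumannHom.PsiME D (Aeps ε) Abar = (1 / 2) * NeumannHom.PsiMS D (Aeps ε) Abar := by
  intro ε hε Abar hAbar
  have hA := hAeps ε hε
  have hB := NeumannHom.isCoeffField_const hAbar D
  refine ⟨NeumannHom.isWellPosed hβ hA hd hD hα, NeumannHom.isWellPosed hβ hB hd hD hα, ?_⟩
  set TA := NeumannHom.neumannToDirichlet hβ hA hd hD hα
  set TB := NeumannHom.neumannToDirichlet hβ hB hd hD hα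
  set M := NeumannHom.meanZeroSubmodule hD
  -- The energies carry a minus sign, so their difference is half the quadratic form of `TB - TA`.
  have hME : NeumannHom.valuesME D (Aeps ε) (fun _ => Abar) =
      (fun g => |(1 / 2) * ⟪g, (TB - TA) g⟫_ℝ|) '' {g | g ∈ M ∧ ‖g‖ = 1} := by
    refine Set.image_congr fun g hg => ?_
    rw [NeumannHom.energy_eq hβ hA hd hD hα hg.1, NeumannHom.energy_eq hβ hB hd hD hα hg.1,
      sub_apply, inner_sub_right]
    congr 1
    ring
  have hMS : NeumannHom.valuesMS D (Aeps ε) (fun _ => Abar) =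
      (fun g => ‖(TB - TA) g‖) '' {g | g ∈ M ∧ ‖g‖ = 1} := by
    refine Set.image_congr fun g hg => ?_
    rw [NeumannHom.solution_eq hβ hA hd hD hα hg.1, NeumannHom.solution_eq hβ hB hd hD hα hg.1,
      sub_apply, norm_sub_rev]
  rw [NeumannHom.PsiME, NeumannHom.PsiMS, hME, hMS]
  refine NeumannHom.bddAbove_and_sSup_eq M (TB - TA) (fun f g => ?_) fun g => ?_
  · rw [sub_apply, sub_apply, inner_sub_right,
      inner_sub_left, NeumannHom.inner_neumannToDirichlet_comm,
      NeumannHom.inner_neumannToDirichlet_comm]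
  · exact M.sub_mem (NeumannHom.neumannToDirichlet_mem hβ hB hd hD hα g)
      (NeumannHom.neumannToDirichlet_mem hβ hA hd hD hα g)
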